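/- **Theorem (Negative solution to the Control Measure Problem).** There exists an exhaustive vector measure, with values in a metrizable topological vector space, that does not have a control measure. Definitions. A *submeasure* on a Boolean algebra $\mathcal B$ is a map $\nu:\mathcal B\to[0,\infty)$ with $\nu(\varnothing)=0$, $\nu(A)\le\nu(B)$ for $A\subset B$, and $\nu(A\cup B)\le\nu(A)+\nu(B)$; it is a *measure* if moreover $\nu(A\cup B)=\nu(A)+\nu(B)$ for disjoint $A,B$. It is *exhaustive* if $\nu(E_n)\to0$ for every disjoint sequence $(E_n)$ in $\mathcal B$, and *uniformly exhaustive* if for every $\varepsilon>0$ there is $n$ such that $\min_{i\le n}\nu(E_i)\le\varepsilon$ for all pairwise disjoint $E_1,\dots,E_n\in\mathcal B$. A submeasure $\nu_1$ is *absolutely continuous* with respect to $\nu_2$ if for every $\varepsilon>0$ there is $\alpha>0$ such that $\nu_2(A)\le\alpha$ implies $\nu_1(A)\le\varepsilon$. Let $X$ be a topological vector space whose topology is defined by a translation invariant metric $d$. A map $\theta:\mathcal B\to X$ is a *vector measure* if $\theta(A\cup B)=\theta(A)+\theta(B)$ for disjoint $A,B$; it is *exhaustive* if $\theta(E_n)\to0$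 for every disjoint sequence $(E_n)$ in $\mathcal B$; a measure $\mu$ on $\mathcal B$ is a *control measure* for $\theta$ if for every $\varepsilon>0$ there is $\alpha>0$ such that $\mu(A)\le\alpha$ implies $d(0,\theta(A))\le\varepsilon$. More precisely, let $\mathcal B$ be the algebra of clopen subsets of the Cantor set $\{0,1\}^{\mathbb N}$, and let $\mathcal L_0$ be the real vector space of $\mathcal B$-measurable (equivalently, locally constant) functions $f:\{0,1\}^{\mathbb N}\to\mathbb R$. There is an exhaustive submeasure $\nu$ on $\mathcal B$, with $\nu(A)>0$ for all $A\ne\varnothing$, that is not uniformly exhaustive and is such that no non-zero measure on $\mathcal B$ is absolutely continuous with respect to $\nu$, for which the following hold: 1. the formula $$d(f,g)=\sup\{\varepsilon:\ \nu(\{|f-g|\ge\varepsilon\})\ge\varepsilon\}$$ defines a translation invariant metric on $\mathcal L_0$, and $\mathcal L_0$ with the topology of $d$ is a topological vector space; 2. the map $\theta:\mathcal B\to\mathcal L_0$, $\theta(A)=1_A$, is an exhaustive vector measure, and no measure on $\mathcal B$ is a control measure for $\theta$. -/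

import Mathlib

open Filter Topology TopologicalSpace

/-- A submeasure on a Boolean algebra. Values are nonnegative, by `bot` and `mono`. -/
structure IsSubmeasure {α : Type*} [BooleanAlgebra α] (ν : α → ℝ) : Prop where
  bot : ν ⊥ = 0
  mono : ∀ A B : α, A ≤ B → ν A ≤ ν B
  subadd : ∀ A B : α, ν (A ⊔ B) ≤ ν A + ν B

/-- A (nonnegative, finitely additive) measure on a Boolean algebra. -/
structure IsFinAddMeasure {α : Type*} [BooleanAlgebra α] (μ : α → ℝ) : Prop
    extends IsSubmeasure μ where
  add : ∀ A B : α, Disjoint A B → μ (A ⊔ B) = μ A + μ B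

/-- `ν A = 0` only for the zero element `A`. -/
def VanishesOnlyAtBot {α : Type*} [BooleanAlgebra α] (ν : α → ℝ) : Prop :=
  ∀ A : α, ν A = 0 → A = ⊥

/-- `φ (E n) → 0` for every disjoint sequence `E`. This is exhaustivity both of submeasures
(`X = ℝ`) and of vector measures. -/
def IsExhaustive {α X : Type*} [BooleanAlgebra α] [Zero X] [TopologicalSpace X]
    (φ : α → X) : Prop :=
  ∀ E : ℕ → α, (∀ m n, m ≠ n → Disjoint (E m) (E n)) →
    Tendsto (fun n => φ (E n)) atTop (𝓝 0)

/-- For every `ε > 0` there is `n` such that among any `n` pairwise disjoint elements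
one has `ν`-value at most `ε`. -/
def IsUniformlyExhaustive {α : Type*} [BooleanAlgebra α] (ν : α → ℝ) : Prop :=
  ∀ ε : ℝ, 0 < ε → ∃ n : ℕ, ∀ E : Fin n → α,
    (∀ i j, i ≠ j → Disjoint (E i) (E j)) → ∃ i, ν (E i) ≤ ε

/-- `ν₁` is absolutely continuous with respect to `ν₂`. -/
def IsAbsCont {α : Type*} [BooleanAlgebra α] (ν₁ ν₂ : α → ℝ) : Prop :=
  ∀ ε : ℝ, 0 < ε → ∃ δ : ℝ, 0 < δ ∧ ∀ A : α, ν₂ A ≤ δ → ν₁ A ≤ ε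

/-- A finitely additive vector measure on a Boolean algebra. -/
def IsVectorMeasure {α X : Type*} [BooleanAlgebra α] [AddCommGroup X] (θ : α → X) : Prop :=
  ∀ A B : α, Disjoint A B → θ (A ⊔ B) = θ A + θ B

/-- `μ` is a control measure for `θ` (with respect to the distance of `X`). -/
structure IsControlMeasure {α X : Type*} [BooleanAlgebra α] [AddCommGroup X] [MetricSpace X]
    (μ : α → ℝ) (θ : α → X) : Prop where
  measure : IsFinAddMeasure μ
  control : ∀ ε : ℝ, 0 < ε → ∃ δ : ℝ, 0 < δ ∧ ∀ A : α, μ A ≤ δ → dist 0 (θ A) ≤ ε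

/-- The Cantor set. -/
abbrev Cantor : Type := ℕ → Bool

/-- A real function on the Cantor set is measurable with respect to the algebra of clopen sets
iff it is locally constant. -/
theorem clopen_measurable_iff_isLocallyConstant (f : Cantor → ℝ) :
    (∀ s : Set ℝ, MeasurableSet s → IsClopen (f ⁻¹' s)) ↔ IsLocallyConstant f := by
  constructor
  · intro h
    rw [IsLocallyConstant.iff_isOpen_fiber]
    exact fun y => (h {y} (measurableSet_singleton y)).isOpen
  · intro h s _
    exact ⟨⟨by simpa using h sᶜ⟩, h s⟩

/-- The vector space of real functions on the Cantor set that are measurable with respect to the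
algebra of clopen sets, that is, of locally constant functions. -/
abbrev CantorL0 : Type := LocallyConstant Cantor ℝ

/-- The clopen set `{|f| ≥ ε}`. -/
def CantorL0.absGE (f : CantorL0) (ε : ℝ) : Clopens Cantor :=
  ⟨{x | ε ≤ |f x|},
    (clopen_measurable_iff_isLocallyConstant f).2 f.isLocallyConstant {r | ε ≤ |r|}
      (measurableSet_le measurable_const measurable_id.abs)⟩

/-- `sup {ε : ν {|f| ≥ ε} ≥ ε}`, the distance from `f` to `0`. -/
noncomputable def CantorL0.size (ν : Clopens Cantor → ℝ) (f : CantorL0) : ℝ :=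
  sSup {ε : ℝ | ε ≤ ν (f.absGE ε)}

/-- The indicator function `1_A`. -/
noncomputable def CantorL0.indicator (A : Clopens Cantor) : CantorL0 :=
  LocallyConstant.charFn ℝ A.isClopen

open scoped ENNReal

/-! The submeasure `cantorSub` is of the kind built by Talagrand, from coverings by weighted pieces.
A piece has a type `k`, a finite set `I` of levels and a carrier that is thin along `I`: for `m < n`
in `I`, inside every cylinder of rank `m` there is a set of rank `n` that avoids the carrier and
has, after rescaling, value at least `1` for the submeasure built from types above `k`. So the
definition runs downwards from a cut-off `p`, and `limSub` sends `p` to infinity along an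
ultrafilter. A piece of type `k` costs `2⁻ᵏ` if `I` is large and more if `I` is small, but the
dependence on the size of `I` is so weak that passing to a portion of `I` is almost free.

Non-degeneracy: a cheap family cannot cover the space (`massBound_le_pre_univ`). By
`exists_avoiding`, a point is built block of coordinates by block of coordinates; each piece of
lowest type is avoided in a gap of its own index set on which the other pieces matter little.
Consequently, prescribing one coordinate leaves a set of value at least `1`
(`one_le_pre_coordinate`), whatever the number of values of this coordinate. This refutes uniform
exhaustivity. It also makes the set of points that miss a prescribed value at every level of a large
`I` thin, hence of value at most `2⁻ᵏ`. Such sets can carry half of any given measure, so no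
non-zero measure is absolutely continuous (`exists_small_half`).

Exhaustivity: given a disjoint sequence, compactness along the ultrafilter yields a large set of
finite rank on which its late terms are negligible (`exists_large_cyl`). Repeating this inside all
cylinders of successive ranks shows that late terms are, up to a small error, thin along an index
set of any prescribed size, hence cheap (`tendsto_limSub_zero`).

The functional `CantorL0.size` is then an F-norm, and the size of an indicator lies between `min 1
(ν A)` and `ν A`. Exhaustivity passes to indicators. A control measure is impossible because one of
the many disjoint sets fixing a block has tiny measure, while its indicator has size at least `1`.
-/

namespace ThinCover

/-! ### Weights and numerical constants -/

/-- Below this cardinality an index set is too expensive to be used in a cheap covering. -/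
def minCard (k : ℕ) : ℕ := 2 ^ (2 * k + 20)

/-- The cardinality at which the weight of type `k` reaches its minimum `2⁻ᵏ`. -/
def maxCard (k : ℕ) : ℕ := 2 ^ (2 * k + 20 + (k + 5) * (k + 6) ^ 3)

/-- Real version of the weight of a set of type `k` that is thin along `n` indices. -/
noncomputable def realWeight (k n : ℕ) : ℝ :=
  (1 / 2) ^ k * max 1 (((maxCard k : ℝ) / (n + 1)) ^ (((k : ℝ) + 6) ^ 3)⁻¹)

/-- The weight of a set of type `k` that is thin along `n` indices. -/
noncomputable def weight (k n : ℕ) : ℝ≥0∞ := ENNReal.ofReal (realWeight k n)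

/-- The growth allowed for the total mass from type `k` to type `k + 1`. -/
noncomputable def ratio (k : ℕ) : ℝ := 1 + 1 / (((k : ℝ) + 1) * (k + 3))

/-- A lower bound for the total mass of the submeasure of type `k`. -/
noncomputable def massBound (k : ℕ) : ℝ := 32 * (1 - 1 / ((k : ℝ) + 2))

lemma realWeight_nonneg (k n : ℕ) : 0 ≤ realWeight k n := by
  unfold realWeight; positivity

lemma half_pow_eq (k : ℕ) : ENNReal.ofReal ((1 / 2) ^ k) = (2⁻¹ : ℝ≥0∞) ^ k := by
  rw [ENNReal.ofReal_pow (by norm_num), one_div, ENNReal.ofReal_inv_of_pos (by norm_num)]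
  simp

lemma half_pow_le_weight (k n : ℕ) : (2⁻¹ : ℝ≥0∞) ^ k ≤ weight k n := by
  rw [← half_pow_eq]
  apply ENNReal.ofReal_le_ofReal
  unfold realWeight
  exact le_mul_of_one_le_right (by positivity) (le_max_left _ _)

lemma weight_maxCard (k : ℕ) : weight k (maxCard k) = (2⁻¹ : ℝ≥0∞) ^ k := by
  rw [← half_pow_eq, weight, realWeight, max_eq_left, mul_one]
  apply Real.rpow_le_one (by positivity) _ (by positivity)
  rw [div_le_one (by positivity)]
  linarith

lemma weight_ne_top (k n : ℕ) : weight k n ≠ ∞ := ENNReal.ofReal_ne_top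

lemma pow_le_rpow_inv {x y : ℝ} (hx : 0 ≤ x) {a b : ℕ} (hb : b ≠ 0) (h : x ^ (a * b) ≤ y) :
    x ^ a ≤ y ^ (b : ℝ)⁻¹ := by
  have h0 : 0 ≤ x ^ a := pow_nonneg hx a
  rw [← Real.pow_rpow_inv_natCast h0 hb, ← pow_mul]
  exact Real.rpow_le_rpow (pow_nonneg hx _) h (by positivity)

/-- The quotient `maxCard k / minCard k` is `2 ^ ((k + 5) * (k + 6) ^ 3)`, so the exponent `(k +
6)⁻³` turns it into `2 ^ (k + 5)`, which beats `2⁻ᵏ` by the factor `32`. -/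
lemma le_weight_of_lt_minCard {k n : ℕ} (h : n < minCard k) : 32 ≤ weight k n := by
  have h1 : (32 : ℝ≥0∞) = ENNReal.ofReal 32 := by simp
  rw [h1]
  apply ENNReal.ofReal_le_ofReal
  have hn : (n : ℝ) + 1 ≤ 2 ^ (2 * k + 20) := by
    have : n + 1 ≤ 2 ^ (2 * k + 20) := h
    exact_mod_cast this
  have h2 : (2 : ℝ) ^ ((k + 5) * (k + 6) ^ 3) ≤ (maxCard k : ℝ) / (n + 1) := by
    rw [le_div_iff₀ (Nat.cast_add_one_pos n)]
    have h4 : (maxCard k : ℝ) = 2 ^ ((k + 5) * (k + 6) ^ 3) * 2 ^ (2 * k + 20) := by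
      rw [← pow_add, add_comm, maxCard, Nat.cast_pow, Nat.cast_ofNat]
    rw [h4]
    exact mul_le_mul_of_nonneg_left hn (pow_nonneg zero_le_two _)
  have h3 : (2 : ℝ) ^ (k + 5) ≤ ((maxCard k : ℝ) / (n + 1)) ^ (((k : ℝ) + 6) ^ 3)⁻¹ := by
    have h5 := pow_le_rpow_inv zero_le_two (pow_ne_zero 3 (Nat.succ_ne_zero (k + 5))) h2
    have h6 : (((k + 5 + 1) ^ 3 : ℕ) : ℝ) = ((k : ℝ) + 6) ^ 3 := by push_cast; ring
    rwa [h6] at h5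
  unfold realWeight
  calc (32 : ℝ) = (1 / 2) ^ k * 2 ^ (k + 5) := by
        rw [pow_add, ← mul_assoc, ← mul_pow]; norm_num
    _ ≤ _ := by
        gcongr
        exact h3.trans (le_max_right _ _)

lemma realWeight_le_rpow_mul {j n n' : ℕ} {L : ℝ} (hL : 1 ≤ L) (h : (n : ℝ) ≤ L * n') :
    realWeight j n' ≤ L ^ (((j : ℝ) + 6) ^ 3)⁻¹ * realWeight j n := by
  unfold realWeight
  set β : ℝ := (((j : ℝ) + 6) ^ 3)⁻¹
  have hβ : 0 ≤ β := by positivity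
  have hLβ : 1 ≤ L ^ β := Real.one_le_rpow hL hβ
  rw [mul_left_comm]
  gcongr
  rw [mul_max_of_nonneg _ _ (by positivity)]
  apply max_le_max (by simpa using hLβ)
  rw [← Real.mul_rpow (by positivity) (by positivity)]
  apply Real.rpow_le_rpow (by positivity) _ hβ
  rw [mul_div_assoc', div_le_div_iff₀ (by positivity) (by positivity)]
  have : (n : ℝ) + 1 ≤ L * (n' + 1) := by linarith
  calc (maxCard j : ℝ) * (n + 1) ≤ maxCard j * (L * (n' + 1)) := by gcongr
    _ = _ := by ring

lemma two_rpow_le {x : ℝ} (h0 : 0 ≤ x) (h1 : x ≤ 1) : (2 : ℝ) ^ x ≤ 1 + x := by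
  have := rpow_one_add_le_one_add_mul_self (s := 1) (p := x) (by norm_num) h0 h1
  norm_num at this
  linarith

lemma weight_le_two_mul {j n n' : ℕ} (h : n ≤ 2 * n') : weight j n' ≤ 2 * weight j n := by
  have h1 : (2 : ℝ≥0∞) = ENNReal.ofReal 2 := by simp
  rw [weight, weight, h1, ← ENNReal.ofReal_mul (by norm_num)]
  apply ENNReal.ofReal_le_ofReal
  refine (realWeight_le_rpow_mul (L := 2) (by norm_num) (n := n) (by exact_mod_cast h)).trans ?_
  have := realWeight_nonneg j n
  gcongr
  have h6 : (((j : ℝ) + 6) ^ 3)⁻¹ ≤ 1 := by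
    apply inv_le_one_of_one_le₀
    apply one_le_pow₀
    have : (0 : ℝ) ≤ j := by positivity
    linarith
  refine (two_rpow_le (by positivity) h6).trans (by linarith)

lemma ratio_pos (k : ℕ) : 0 < ratio k := by unfold ratio; positivity

lemma ratio_le_two (k : ℕ) : ratio k ≤ 2 := by
  unfold ratio
  have : 1 / (((k : ℝ) + 1) * (k + 3)) ≤ 1 := by
    rw [div_le_one (by positivity)]
    nlinarith [(by positivity : (0 : ℝ) ≤ k)]
  linarith

/-- The price of keeping a fraction `2 ^ -(k + 7)` of the indices at a higher type is at most `2 ^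
((k + 7) / (k + 7) ^ 3) ≤ 1 + (k + 7)⁻²`. The cube in the exponent of the weight is there to make
these losses multiply to a finite constant. -/
lemma weight_le_ratio_mul {k j n n' : ℕ} (hkj : k < j) (h : n ≤ 2 ^ (k + 7) * n') :
    weight j n' ≤ ENNReal.ofReal (ratio k) * weight j n := by
  rw [weight, weight, ← ENNReal.ofReal_mul (ratio_pos k).le]
  apply ENNReal.ofReal_le_ofReal
  refine (realWeight_le_rpow_mul (L := 2 ^ (k + 7)) (one_le_pow₀ (by norm_num)) (n := n)
    (by exact_mod_cast h)).trans ?_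
  have := realWeight_nonneg j n
  gcongr
  have hk : (0 : ℝ) ≤ k := by positivity
  have hj : (k : ℝ) + 1 ≤ j := by exact_mod_cast hkj
  calc ((2 : ℝ) ^ (k + 7)) ^ (((j : ℝ) + 6) ^ 3)⁻¹
      ≤ ((2 : ℝ) ^ (k + 7)) ^ (((k : ℝ) + 7) ^ 3)⁻¹ := by
        apply Real.rpow_le_rpow_of_exponent_le (one_le_pow₀ (by norm_num))
        gcongr ?_⁻¹
        gcongr ?_ ^ 3
        linarith
    _ = (2 : ℝ) ^ ((((k : ℝ) + 7) ^ 2)⁻¹) := by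
        rw [← Real.rpow_natCast, ← Real.rpow_mul (by norm_num)]
        congr 1
        push_cast
        field_simp
    _ ≤ 1 + (((k : ℝ) + 7) ^ 2)⁻¹ := by
        apply two_rpow_le (by positivity)
        apply inv_le_one_of_one_le₀
        apply one_le_pow₀
        linarith
    _ ≤ ratio k := by
        unfold ratio
        rw [one_div]
        gcongr
        nlinarith

/-- The losses telescope, so the lower bounds stay between `16` and `32` for all types. -/
lemma ratio_mul_massBound (k : ℕ) : ratio k * massBound k = massBound (k + 1) := by
  unfold ratio massBound
  push_cast
  field_simp
  ring

lemma le_massBound (k : ℕ) : 16 ≤ massBound k := by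
  unfold massBound
  have : 1 / ((k : ℝ) + 2) ≤ 1 / 2 := by
    apply one_div_le_one_div_of_le (by norm_num)
    linarith [(by positivity : (0 : ℝ) ≤ k)]
  linarith

lemma massBound_le (k : ℕ) : massBound k ≤ 32 := by
  unfold massBound
  have : 0 ≤ 1 / ((k : ℝ) + 2) := by positivity
  linarith

/-! ### Gaps in finite sets of integers -/

section Combinatorics

/-- Among nonempty finite families of sets with more than `L` elements, one is the first to
collect `L + 1` elements. -/
lemma exists_first_initial_segment {ι : Type*} {s : Finset ι} (hs : s.Nonempty)
    (A : ι → Finset ℕ) (L : ℕ) (hA : ∀ e ∈ s, L + 1 ≤ (A e).card) :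
    ∃ e₀ ∈ s, ∃ t, L + 1 ≤ ((A e₀).filter (· ≤ t)).card ∧
      ∀ e ∈ s, ((A e).filter (· < t)).card ≤ L := by
  classical
  have hex : ∃ t, ∃ e ∈ s, L + 1 ≤ ((A e).filter (· ≤ t)).card := by
    obtain ⟨e, he⟩ := hs
    refine ⟨(A e).sup id, e, he, ?_⟩
    rw [Finset.filter_true_of_mem]
    · exact hA e he
    · intro x hx
      exact Finset.le_sup (f := id) hx
  obtain ⟨e₀, he₀, h₀⟩ := Nat.find_spec hex
  refine ⟨e₀, he₀, Nat.find hex, h₀, fun e he => ?_⟩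
  by_contra! hlt
  obtain ⟨x, hx⟩ : ((A e).filter (· < Nat.find hex)).Nonempty := Finset.card_pos.1 (by omega)
  have hpos : 0 < Nat.find hex := by
    have := (Finset.mem_filter.1 hx).2
    omega
  refine Nat.find_min hex (m := Nat.find hex - 1) (by omega) ⟨e, he, ?_⟩
  refine hlt.trans_le (Finset.card_le_card fun y hy => ?_)
  rw [Finset.mem_filter] at hy ⊢
  exact ⟨hy.1, by omega⟩

/-- The elements of `J` in the interval `[m, n)`. -/
def between (m n : ℕ) (J : Finset ℕ) : Finset ℕ := J.filter fun i => m ≤ i ∧ i < n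

/-- The elements of `J` that are at least `m`. -/
def above (m : ℕ) (J : Finset ℕ) : Finset ℕ := J.filter fun i => m ≤ i

/-- The elements of `J` that are smaller than `m`. -/
def below (m : ℕ) (J : Finset ℕ) : Finset ℕ := J.filter fun i => i < m

lemma card_below_add_card_above (m : ℕ) (J : Finset ℕ) :
    (below m J).card + (above m J).card = J.card := by
  have := Finset.card_filter_add_card_filter_not (s := J) (fun i => i < m)
  simpa only [below, above, not_lt] using this

lemma card_above_eq {q m n : ℕ} (hqm : q ≤ m) (hmn : m ≤ n) (J : Finset ℕ) :
    (above q J).card = (between q m J).card + (between m n J).card + (above n J).card := by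
  classical
  rw [← Finset.card_union_of_disjoint, ← Finset.card_union_of_disjoint]
  · congr 1
    ext i
    simp only [above, between, Finset.mem_union, Finset.mem_filter]
    constructor
    · rintro ⟨h1, h2⟩
      by_cases h3 : i < m
      · exact Or.inl (Or.inl ⟨h1, h2, h3⟩)
      · by_cases h4 : i < n
        · exact Or.inl (Or.inr ⟨h1, by omega, h4⟩)
        · exact Or.inr ⟨h1, by omega⟩
    · rintro ((⟨h1, h2, h3⟩ | ⟨h1, h2, h3⟩) | ⟨h1, h2⟩) <;> exact ⟨h1, by omega⟩
  · rw [Finset.disjoint_left]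
    intro i hi hj
    simp only [above, between, Finset.mem_union, Finset.mem_filter] at hi hj
    omega
  · rw [Finset.disjoint_left]
    intro i hi hj
    simp only [between, Finset.mem_filter] at hi hj
    omega

/-- Some gap of a set with more than `L` elements carries a small portion of a finite weighted
family of sets of integers. -/
lemma exists_light_gap {ι : Type*} (A : Finset ℕ) {L : ℕ} (hL : 0 < L) (hA : L + 1 ≤ A.card)
    (R : ℕ) (G : Finset ι) (J : ι → Finset ℕ) (hJ : ∀ e ∈ G, 0 < (J e).card) (w : ι → ℝ≥0∞) :
    ∃ m ∈ A, ∃ n ∈ A, m < n ∧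
      (∑ e ∈ G.filter (fun e => (J e).card ≤ R * (between m n (J e)).card), w e) * L
        ≤ R * ∑ e ∈ G, w e := by
  classical
  let u := A.orderEmbOfCardLe hA
  have hu : StrictMono u := u.strictMono
  let H : Fin L → Finset ι := fun i =>
    G.filter (fun e => (J e).card ≤ R * (between (u i.castSucc) (u i.succ) (J e)).card)
  -- The gaps are disjoint, and each gap that counts for `e` holds at least a fraction `1 / R` of `J
  -- e`; the bound follows by averaging over the `L` gaps.
  have hcount : ∀ e ∈ G, ((Finset.univ.filter fun i => e ∈ H i).card) ≤ R := by
    intro e he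
    set S := Finset.univ.filter fun i => e ∈ H i
    have h1 : S.card * (J e).card ≤
        ∑ i ∈ S, R * (between (u i.castSucc) (u i.succ) (J e)).card := by
      rw [← smul_eq_mul]
      apply Finset.card_nsmul_le_sum
      intro i hi
      exact (Finset.mem_filter.1 (Finset.mem_filter.1 hi).2).2
    have h2 : ∑ i ∈ S, (between (u i.castSucc) (u i.succ) (J e)).card ≤ (J e).card := by
      rw [← Finset.card_biUnion]
      · apply Finset.card_le_card
        intro x hx
        obtain ⟨i, -, hi⟩ := Finset.mem_biUnion.1 hx
        exact (Finset.mem_filter.1 hi).1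
      · have key : ∀ i j : Fin L, i < j →
            Disjoint (between (u i.castSucc) (u i.succ) (J e))
              (between (u j.castSucc) (u j.succ) (J e)) := by
          intro i j hij
          have hle : u i.succ ≤ u j.castSucc := hu.monotone (Fin.succ_le_castSucc_iff.2 hij)
          rw [Finset.disjoint_left]
          intro x hx hy
          simp only [between, Finset.mem_filter] at hx hy
          omega
        intro i _ j _ hij
        rcases lt_or_gt_of_ne hij with h | h
        · exact key i j h
        · exact (key j i h).symm
    rw [← Finset.mul_sum] at h1
    have h3 : S.card * (J e).card ≤ R * (J e).card := h1.trans (Nat.mul_le_mul_left _ h2)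
    exact Nat.le_of_mul_le_mul_right h3 (hJ e he)
  have hsum : ∑ i : Fin L, (∑ e ∈ H i, w e) * L ≤ ∑ _i : Fin L, R * ∑ e ∈ G, w e := by
    rw [← Finset.sum_mul, Finset.sum_const, Finset.card_univ, Fintype.card_fin, nsmul_eq_mul,
      mul_comm]
    gcongr
    have : ∀ i : Fin L, ∑ e ∈ H i, w e = ∑ e ∈ G, if e ∈ H i then w e else 0 := by
      intro i
      rw [← Finset.sum_filter]
      congr 1
      ext e
      simp only [H, Finset.mem_filter]
      tauto
    simp_rw [this]
    rw [Finset.sum_comm, Finset.mul_sum]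
    apply Finset.sum_le_sum
    intro e he
    rw [← Finset.sum_filter, Finset.sum_const, nsmul_eq_mul]
    gcongr
    exact_mod_cast hcount e he
  have : Nonempty (Fin L) := ⟨⟨0, hL⟩⟩
  obtain ⟨i, -, hi⟩ := ENNReal.exists_le_of_sum_le (s := Finset.univ) Finset.univ_nonempty hsum
  exact ⟨_, Finset.orderEmbOfCardLe_mem _ hA i.castSucc, _,
    Finset.orderEmbOfCardLe_mem _ hA i.succ, hu Fin.castSucc_lt_succ, hi⟩

end Combinatorics

/-! ### Cylinders and thin sets -/

section Space

variable {α : ℕ → Type*}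

/-- The point with the first `m` coordinates of `a` and the other coordinates of `z`. -/
def splice (m : ℕ) (a z : ∀ n, α n) : ∀ n, α n := fun i => if i < m then a i else z i

/-- `D` depends on the first `n` coordinates only. -/
def IsCyl (n : ℕ) (D : Set (∀ n, α n)) : Prop :=
  ∀ ⦃z y : ∀ n, α n⦄, (∀ i < n, z i = y i) → z ∈ D → y ∈ D

/-- The smallest set containing `X` that depends on the first `n` coordinates only. -/
def hull (n : ℕ) (X : Set (∀ n, α n)) : Set (∀ n, α n) := {z | ∃ y ∈ X, ∀ i < n, z i = y i}

/-- The set `X` is thin along `I` with respect to `ν`: for `m < n` in `I`, in every cylinder of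
rank `m` there is a set of rank `n` that is disjoint from `X` and large for `ν` after rescaling. -/
def Thin (ν : Set (∀ n, α n) → ℝ≥0∞) (I : Finset ℕ) (X : Set (∀ n, α n)) : Prop :=
  ∀ m ∈ I, ∀ n ∈ I, m < n → ∀ a : ∀ n, α n,
    ∃ D, IsCyl n D ∧ 1 ≤ ν D ∧ ∀ z ∈ D, splice m a z ∉ X

lemma splice_of_lt {m i : ℕ} (h : i < m) (a z : ∀ n, α n) : splice m a z i = a i := if_pos h

lemma splice_of_le {m i : ℕ} (h : m ≤ i) (a z : ∀ n, α n) : splice m a z i = z i :=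
  if_neg h.not_gt

lemma splice_eq_self {m : ℕ} {a z : ∀ n, α n} (h : ∀ i < m, z i = a i) : splice m a z = z := by
  funext i
  by_cases hi : i < m
  · rw [splice_of_lt hi, h i hi]
  · exact splice_of_le (not_lt.1 hi) a z

lemma splice_splice_of_le {q m : ℕ} (h : q ≤ m) (a b z : ∀ n, α n) :
    splice q a (splice m b z) = splice m (splice q a b) z := by
  funext i
  simp only [splice]
  split_ifs <;> first | rfl | omega

lemma splice_splice_self (m : ℕ) (a b z : ∀ n, α n) :
    splice m a (splice m b z) = splice m a z := by
  funext i
  simp only [splice]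
  split_ifs <;> rfl

lemma IsCyl.mono {m n : ℕ} (h : m ≤ n) {D : Set (∀ n, α n)} (hD : IsCyl m D) : IsCyl n D :=
  fun _ _ hzy hz => hD (fun i hi => hzy i (hi.trans_le h)) hz

lemma IsCyl.compl {n : ℕ} {D : Set (∀ n, α n)} (hD : IsCyl n D) : IsCyl n Dᶜ :=
  fun _ _ hzy hz hy => hz (hD (fun i hi => (hzy i hi).symm) hy)

lemma isCyl_hull (n : ℕ) (X : Set (∀ n, α n)) : IsCyl n (hull n X) := by
  rintro z y hzy ⟨x, hx, hxz⟩
  exact ⟨x, hx, fun i hi => (hzy i hi).symm.trans (hxz i hi)⟩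

lemma isCyl_iUnion {ι : Sort*} {n : ℕ} {D : ι → Set (∀ n, α n)} (h : ∀ i, IsCyl n (D i)) :
    IsCyl n (⋃ i, D i) := by
  intro z y hzy hz
  obtain ⟨i, hi⟩ := Set.mem_iUnion.1 hz
  exact Set.mem_iUnion.2 ⟨i, h i hzy hi⟩

lemma hull_anti {m n : ℕ} (h : m ≤ n) (X : Set (∀ n, α n)) : hull n X ⊆ hull m X :=
  fun _ ⟨y, hy, hzy⟩ => ⟨y, hy, fun i hi => hzy i (hi.trans_le h)⟩

variable {ν : Set (∀ n, α n) → ℝ≥0∞} {I J : Finset ℕ} {X : Set (∀ n, α n)}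

lemma Thin.subset (h : Thin ν I X) (hJ : J ⊆ I) : Thin ν J X :=
  fun m hm n hn => h m (hJ hm) n (hJ hn)

/-- All levels are at least `q`, so the frozen coordinates can be absorbed into the base point. -/
lemma Thin.pullback (h : Thin ν I X) {q : ℕ} (hI : ∀ m ∈ I, q ≤ m) (a : ∀ n, α n) :
    Thin ν I {z | splice q a z ∈ X} := by
  intro m hm n hn hmn b
  obtain ⟨D, hD, hD1, hDX⟩ := h m hm n hn hmn (splice q a b)
  refine ⟨D, hD, hD1, fun z hz hzX => hDX z hz ?_⟩
  rwa [← splice_splice_of_le (hI m hm)]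

/-- The witnesses have rank at most `q`, so they cannot distinguish the set from its hull. -/
lemma Thin.hull (h : Thin ν I X) {q : ℕ} (hI : ∀ m ∈ I, m ≤ q) : Thin ν I (hull q X) := by
  intro m hm n hn hmn a
  obtain ⟨D, hD, hD1, hDX⟩ := h m hm n hn hmn a
  refine ⟨D, hD, hD1, ?_⟩
  rintro z hz ⟨y, hy, hzy⟩
  refine hDX (splice m z y) (hD (fun i hi => ?_) hz) ?_
  · by_cases him : i < m
    · rw [splice_of_lt him]
    · rw [splice_of_le (not_lt.1 him), ← hzy i (hi.trans_le (hI n hn)),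
        splice_of_le (not_lt.1 him)]
  · rw [splice_splice_self, splice_eq_self]
    · exact hy
    · intro i hi
      rw [← hzy i (hi.trans_le (hI m hm)), splice_of_lt hi]

lemma Thin.preimage (h : Thin ν I X) (g : ∀ i, α i → α i)
    (hν : ∀ B, ν ((fun z i => g i (z i)) ⁻¹' B) = ν B) :
    Thin ν I ((fun z i => g i (z i)) ⁻¹' X) := by
  intro m hm n hn hmn a
  obtain ⟨D, hD, hD1, hDX⟩ := h m hm n hn hmn (fun i => g i (a i))
  refine ⟨(fun z i => g i (z i)) ⁻¹' D, ?_, by rwa [hν], fun z hz hzX => hDX _ hz ?_⟩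
  · intro z y hzy hz
    exact hD (fun i hi => congrArg (g i) (hzy i hi)) hz
  · have : splice m (fun i => g i (a i)) (fun i => g i (z i)) =
        fun i => g i (splice m a z i) := by
      funext i
      by_cases hi : i < m
      · simp only [splice_of_lt hi]
      · simp only [splice_of_le (not_lt.1 hi)]
    rw [this]
    exact hzX

end Space

/-! ### Coverings by pieces and the recursive submeasures -/

section Cover

variable (α : ℕ → Type*)

/-- A set with a type and a finite set of indices, which determine its cost. -/
structure Piece where
  /-- the type -/
  kind : ℕ
  /-- the set of indices -/
  idx : Finset ℕ
  /-- the underlying set -/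
  carrier : Set (∀ n, α n)

variable {α}

/-- The cost of using a piece in a covering. -/
noncomputable def Piece.cost (e : Piece α) : ℝ≥0∞ := weight e.kind e.idx.card

/-- The cheapest cost of a finite covering by pieces from the class `C`. -/
noncomputable def cov (C : Set (Piece α)) (B : Set (∀ n, α n)) : ℝ≥0∞ :=
  ⨅ (F : Finset (Piece α)) (_ : ↑F ⊆ C) (_ : ∀ z ∈ B, ∃ e ∈ F, z ∈ e.carrier), ∑ e ∈ F, e.cost

variable {C C' : Set (Piece α)} {A B : Set (∀ n, α n)}

lemma cov_le {F : Finset (Piece α)} (hF : ↑F ⊆ C) (hB : ∀ z ∈ B, ∃ e ∈ F, z ∈ e.carrier) :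
    cov C B ≤ ∑ e ∈ F, e.cost :=
  iInf_le_of_le F (iInf_le_of_le hF (iInf_le _ hB))

lemma exists_cover_of_cov_lt {c : ℝ≥0∞} (h : cov C B < c) :
    ∃ F : Finset (Piece α), ↑F ⊆ C ∧ (∀ z ∈ B, ∃ e ∈ F, z ∈ e.carrier) ∧
      ∑ e ∈ F, e.cost < c := by
  simp only [cov, iInf_lt_iff] at h
  obtain ⟨F, h1, h2, h3⟩ := h
  exact ⟨F, h1, h2, h3⟩

lemma le_cov {c : ℝ≥0∞} (h : ∀ F : Finset (Piece α), ↑F ⊆ C →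
    (∀ z ∈ B, ∃ e ∈ F, z ∈ e.carrier) → c ≤ ∑ e ∈ F, e.cost) : c ≤ cov C B :=
  le_iInf fun F => le_iInf fun h1 => le_iInf fun h2 => h F h1 h2

lemma cov_empty : cov C ∅ = 0 := by
  apply le_antisymm _ zero_le
  simpa using cov_le (C := C) (B := ∅) (F := ∅) (by simp) (by simp)

lemma cov_mono (h : A ⊆ B) : cov C A ≤ cov C B :=
  le_cov fun _ h1 h2 => cov_le h1 fun z hz => h2 z (h hz)

lemma cov_anti (h : C ⊆ C') : cov C' B ≤ cov C B :=
  le_cov fun _ h1 h2 => cov_le (h1.trans h) h2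

lemma cov_le_cost {e : Piece α} (he : e ∈ C) (hB : B ⊆ e.carrier) : cov C B ≤ e.cost := by
  simpa using cov_le (C := C) (B := B) (F := {e}) (by simpa using he)
    fun z hz => ⟨e, by simp, hB hz⟩

lemma cov_union_le (A B : Set (∀ n, α n)) : cov C (A ∪ B) ≤ cov C A + cov C B := by
  classical
  refine ENNReal.le_of_forall_pos_le_add fun ε hε hlt => ?_
  have hA : cov C A ≠ ∞ := (lt_of_le_of_lt le_self_add hlt).ne
  have hB : cov C B ≠ ∞ := (lt_of_le_of_lt le_add_self hlt).ne
  have hε' : (ε / 2 : ℝ≥0∞) ≠ 0 := by simpa using hε.ne'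
  obtain ⟨F, hF, hFA, hFw⟩ := exists_cover_of_cov_lt (ENNReal.lt_add_right hA hε')
  obtain ⟨F', hF', hFB, hFw'⟩ := exists_cover_of_cov_lt (ENNReal.lt_add_right hB hε')
  calc cov C (A ∪ B) ≤ ∑ e ∈ F ∪ F', e.cost := by
        apply cov_le
        · rw [Finset.coe_union]; exact Set.union_subset hF hF'
        · rintro z (hz | hz)
          · obtain ⟨e, he, h⟩ := hFA z hz
            exact ⟨e, Finset.mem_union_left _ he, h⟩
          · obtain ⟨e, he, h⟩ := hFB z hz
            exact ⟨e, Finset.mem_union_right _ he, h⟩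
    _ ≤ ∑ e ∈ F, e.cost + ∑ e ∈ F', e.cost := by
        rw [← Finset.sum_union_inter]; exact le_self_add
    _ ≤ (cov C A + ε / 2) + (cov C B + ε / 2) := add_le_add hFw.le hFw'.le
    _ = cov C A + cov C B + ε := by rw [add_add_add_comm, ENNReal.add_halves]

lemma cov_le_sum_cov {ι : Type*} (s : Finset ι) (A : ι → Set (∀ n, α n))
    (hB : ∀ z ∈ B, ∃ i ∈ s, z ∈ A i) : cov C B ≤ ∑ i ∈ s, cov C (A i) := by
  classical
  induction s using Finset.induction_on generalizing B with
  | empty =>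
    have : B = ∅ := by
      ext z
      simpa using fun hz => hB z hz
    simp [this, cov_empty]
  | insert i s hi ih =>
    rw [Finset.sum_insert hi]
    calc cov C B ≤ cov C (A i ∪ (B \ A i)) := cov_mono (by simp)
      _ ≤ cov C (A i) + cov C (B \ A i) := cov_union_le _ _
      _ ≤ _ := by
        gcongr
        apply ih
        rintro z ⟨hz, hzi⟩
        obtain ⟨j, hj, hzj⟩ := hB z hz
        rcases Finset.mem_insert.1 hj with rfl | hj
        · exact absurd hzj hzi
        · exact ⟨j, hj, hzj⟩

lemma cov_le_sum {ι : Type*} (s : Finset ι) (f : ι → Piece α) (hf : ∀ i ∈ s, f i ∈ C)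
    (hB : ∀ z ∈ B, ∃ i ∈ s, z ∈ (f i).carrier) : cov C B ≤ ∑ i ∈ s, (f i).cost :=
  (cov_le_sum_cov s _ hB).trans (Finset.sum_le_sum fun i hi => cov_le_cost (hf i hi) subset_rfl)

/-- The class of admissible pieces of the last `i` types before type `p`. -/
def pieces (p : ℕ) : ℕ → Set (Piece α)
  | 0 => ∅
  | i + 1 => pieces p i ∪
      {e | e.kind + (i + 1) = p ∧ Thin (cov (pieces p i)) e.idx e.carrier}

/-- The class of admissible pieces of types `k, …, p - 1`. -/
def family (α : ℕ → Type*) (p k : ℕ) : Set (Piece α) := pieces p (p - k)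

/-- The submeasure obtained from coverings by admissible pieces of types `k, …, p - 1`. -/
noncomputable def pre (p k : ℕ) (B : Set (∀ n, α n)) : ℝ≥0∞ := cov (family α p k) B

lemma mem_pieces {p i : ℕ} {e : Piece α} : e ∈ pieces p i ↔
    ∃ j < i, e.kind + (j + 1) = p ∧ Thin (cov (pieces p j)) e.idx e.carrier := by
  induction i with
  | zero => simp [pieces]
  | succ i ih =>
    simp only [pieces, Set.mem_union, ih, Set.mem_ofPred_eq, Nat.lt_succ_iff_lt_or_eq, or_and_right,
      exists_or, exists_eq_left]

lemma mem_family {p k : ℕ} {e : Piece α} : e ∈ family α p k ↔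
    k ≤ e.kind ∧ e.kind < p ∧ Thin (pre p (e.kind + 1)) e.idx e.carrier := by
  unfold pre family
  rw [mem_pieces]
  constructor
  · rintro ⟨j, hj, hp, h⟩
    obtain rfl : j = p - (e.kind + 1) := by omega
    exact ⟨by omega, by omega, h⟩
  · rintro ⟨h1, h2, h⟩
    exact ⟨p - (e.kind + 1), by omega, by omega, h⟩

lemma family_anti {p k l : ℕ} (h : k ≤ l) : family α p l ⊆ family α p k := by
  intro e he
  rw [mem_family] at he ⊢
  exact ⟨h.trans he.1, he.2⟩

lemma pre_mono_index {p k l : ℕ} (h : k ≤ l) (B : Set (∀ n, α n)) : pre p k B ≤ pre p l B :=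
  cov_anti (family_anti h)

lemma family_trunc {p k : ℕ} {e : Piece α} (he : e ∈ family α p k) {J : Finset ℕ}
    {X : Set (∀ n, α n)} (hX : Thin (pre p (e.kind + 1)) J X) :
    (⟨e.kind, J, X⟩ : Piece α) ∈ family α p k := by
  rw [mem_family] at he ⊢
  exact ⟨he.1, he.2.1, hX⟩

lemma Thin.rescale {ν : Set (∀ n, α n) → ℝ≥0∞} {I : Finset ℕ} {X : Set (∀ n, α n)}
    (h : Thin ν I X) (q m : ℕ) (a : ∀ n, α n) :
    Thin ν (between q m I) (ThinCover.hull m {z | splice q a z ∈ X}) := by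
  have h1 : Thin ν (between q m I) X := h.subset (Finset.filter_subset _ _)
  refine Thin.hull (Thin.pullback h1 ?_ a) ?_ <;>
  · intro i hi
    have := (Finset.mem_filter.1 hi).2
    omega

end Cover

/-! ### Lower bound for the total mass -/

section

variable {α : ℕ → Type*} {p k : ℕ}

/-- If a set is large compared with the costs of some pieces, it has a point outside of given
truncations of these pieces. -/
lemma exists_mem_forall_not_mem {D : Set (∀ n, α n)} {G : Finset (Piece α)}
    (hG : ∀ e ∈ G, e ∈ family α p (k + 1)) (J : Piece α → Finset ℕ)
    (hJ : ∀ e ∈ G, e.idx.card ≤ 2 ^ (k + 7) * (J e).card) (X : Piece α → Set (∀ n, α n))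
    (hX : ∀ e ∈ G, Thin (pre p (e.kind + 1)) (J e) (X e))
    (hD : ENNReal.ofReal (ratio k) * ∑ e ∈ G, e.cost < pre p (k + 1) D) :
    ∃ z ∈ D, ∀ e ∈ G, z ∉ X e := by
  by_contra! hcov
  refine hD.not_ge ?_
  calc pre p (k + 1) D ≤ ∑ e ∈ G, (⟨e.kind, J e, X e⟩ : Piece α).cost :=
        cov_le_sum G _ (fun e he => family_trunc (hG e he) (hX e he)) hcov
    _ ≤ ∑ e ∈ G, ENNReal.ofReal (ratio k) * e.cost :=
        Finset.sum_le_sum fun e he =>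
          weight_le_ratio_mul (mem_family.1 (hG e he)).1 (hJ e he)
    _ = _ := (Finset.mul_sum _ _ _).symm

/-- Here `x` is the cost of the pieces that matter in a light gap: at most `2⁻⁷` of a total below
`32`. Even after the loss `ratio k ≤ 2` it stays below `1`, the size guaranteed by thinness. -/
lemma ratio_mul_lt_one {x : ℝ≥0∞} {S : ℝ≥0∞} (hS : S < ENNReal.ofReal (massBound k))
    (h : x * (2 ^ (k + 14) : ℕ) ≤ (2 ^ (k + 7) : ℕ) * S) : ENNReal.ofReal (ratio k) * x < 1 := by
  have h1 : x * 2 ^ 7 ≤ S := by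
    have h2 : x * 2 ^ 7 * 2 ^ (k + 7) ≤ S * 2 ^ (k + 7) := by
      push_cast at h
      rw [mul_assoc, ← pow_add, mul_comm S]
      convert h using 3
      ring
    exact (ENNReal.mul_le_mul_iff_left (by simp) (by simp)).1 h2
  have h2 : x * 2 ^ 7 < 32 := by
    refine h1.trans_lt (hS.trans_le ?_)
    simpa using ENNReal.ofReal_le_ofReal (massBound_le k)
  have h3 : x < 2⁻¹ := by
    by_contra! hx
    refine h2.not_ge ?_
    calc (32 : ℝ≥0∞) ≤ 64 := by norm_num
      _ = 2⁻¹ * 2 ^ 7 := by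
        rw [pow_succ', ← mul_assoc, ENNReal.inv_mul_cancel (by simp) (by simp)]; norm_num
      _ ≤ _ := by gcongr
  calc ENNReal.ofReal (ratio k) * x ≤ 2 * x := by
        gcongr
        simpa using ENNReal.ofReal_le_ofReal (ratio_le_two k)
    _ < 2 * 2⁻¹ := by
        exact (ENNReal.mul_lt_mul_iff_right (by simp) (by simp)).2 h3
    _ = 1 := ENNReal.mul_inv_cancel (by simp) (by simp)

/-- Pieces of type `k` with large sets of indices, and cheap families of pieces of higher types,
can be avoided simultaneously. -/
lemma exists_avoiding
    (h1 : ENNReal.ofReal (massBound (k + 1)) ≤ pre p (k + 1) (Set.univ : Set (∀ n, α n)))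
    (N : ℕ) : ∀ (s G : Finset (Piece α)) (q : ℕ) (a : ∀ n, α n), s.card = N →
    (∀ e ∈ s, Thin (pre p (k + 1)) e.idx e.carrier) →
    (∀ e ∈ s, N * 2 ^ (k + 14) + 1 ≤ (above q e.idx).card) →
    (∀ e ∈ G, e ∈ family α p (k + 1)) →
    (∀ e ∈ G, 0 < e.idx.card) →
    (∀ e ∈ G, (2 * N + 1) * e.idx.card ≤ 2 ^ (k + 7) * (above q e.idx).card) →
    ∑ e ∈ G, e.cost < ENNReal.ofReal (massBound k) →
    ∃ z : ∀ n, α n, (∀ i < q, z i = a i) ∧ (∀ e ∈ s, z ∉ e.carrier) ∧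
      ∀ e ∈ G, z ∉ e.carrier := by
  classical
  have hbig : ∀ G : Finset (Piece α), ∑ e ∈ G, e.cost < ENNReal.ofReal (massBound k) →
      ENNReal.ofReal (ratio k) * ∑ e ∈ G, e.cost < pre p (k + 1) (Set.univ : Set (∀ n, α n)) := by
    intro G hG
    refine lt_of_lt_of_le ?_ h1
    rw [← ratio_mul_massBound, ENNReal.ofReal_mul (ratio_pos k).le]
    exact (ENNReal.mul_lt_mul_iff_right (by simpa using ratio_pos k) ENNReal.ofReal_ne_top).2 hG
  induction N with
  | zero =>
    intro s G q a hs _ _ hG _ hGq hGw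
    obtain ⟨z, -, hz⟩ := exists_mem_forall_not_mem hG (fun e => above q e.idx)
      (fun e he => by simpa using hGq e he) (fun e => {z | splice q a z ∈ e.carrier})
      (fun e he => ((mem_family.1 (hG e he)).2.2.subset (Finset.filter_subset _ _)).pullback
        (fun i hi => (Finset.mem_filter.1 hi).2) a) (hbig G hGw)
    refine ⟨splice q a z, fun i hi => splice_of_lt hi a z, ?_, hz⟩
    simp [Finset.card_eq_zero.1 hs]
  | succ N ih =>
    intro s G q a hs hsT hsq hG hG0 hGq hGw
    have hsne : s.Nonempty := Finset.card_pos.1 (by omega)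
    -- Treating the piece that fills up first costs each other piece of `s` at most `2 ^ (k + 14)`
    -- indices, which the hypothesis on `above q` provides for.
    obtain ⟨e₀, he₀, t, ht, hlow⟩ := exists_first_initial_segment hsne
      (fun e => above q e.idx) (2 ^ (k + 14)) (fun e he => by
        refine le_trans ?_ (hsq e he)
        rw [Nat.succ_mul]; omega)
    obtain ⟨m, hm, n, hn, hmn, hgap⟩ := exists_light_gap _ (by positivity) ht (2 ^ (k + 7)) G
      Piece.idx hG0 Piece.cost
    rw [Finset.mem_filter] at hm hn
    have hqm : q ≤ m := (Finset.mem_filter.1 hm.1).2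
    have hmI : m ∈ e₀.idx := (Finset.mem_filter.1 hm.1).1
    have hnI : n ∈ e₀.idx := (Finset.mem_filter.1 hn.1).1
    set G₁ := G.filter fun e => e.idx.card ≤ 2 ^ (k + 7) * (between q m e.idx).card with hG₁
    set G₂ := G.filter fun e => e.idx.card ≤ 2 ^ (k + 7) * (between m n e.idx).card with hG₂
    set G₃ := G.filter fun e => e ∉ G₁ ∧ e ∉ G₂ with hG₃
    have hsub : ∀ H ⊆ G, ∑ e ∈ H, e.cost < ENNReal.ofReal (massBound k) := fun H hH =>
      (Finset.sum_le_sum_of_subset hH).trans_lt hGw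
    have hthin : ∀ e ∈ G, Thin (pre p (e.kind + 1)) e.idx e.carrier := fun e he =>
      (mem_family.1 (hG e he)).2.2
    have hsub₁ : G₁ ⊆ G := Finset.filter_subset _ _
    have hsub₂ : G₂ ⊆ G := Finset.filter_subset _ _
    have hsub₃ : G₃ ⊆ G := Finset.filter_subset _ _
    -- Coordinates in `[q, m)` take care of `G₁`. Avoiding the hulls, and not only the carriers,
    -- makes the choice final whatever comes later.
    obtain ⟨z₁, -, hz₁⟩ := exists_mem_forall_not_mem (fun e he => hG e (hsub₁ he))
      (fun e => between q m e.idx) (fun e he => (Finset.mem_filter.1 he).2)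
      (fun e => hull m {z | splice q a z ∈ e.carrier})
      (fun e he => (hthin e (hsub₁ he)).rescale q m a) (hbig G₁ (hsub G₁ hsub₁))
    obtain ⟨D, hD, hD1, hDX⟩ := hsT e₀ he₀ m hmI n hnI hmn (splice q a z₁)
    obtain ⟨z₂, hz₂D, hz₂⟩ := exists_mem_forall_not_mem (fun e he => hG e (hsub₂ he))
      (fun e => between m n e.idx) (fun e he => (Finset.mem_filter.1 he).2)
      (fun e => hull n {z | splice m (splice q a z₁) z ∈ e.carrier})
      (fun e he => (hthin e (hsub₂ he)).rescale m n _)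
      (lt_of_lt_of_le (ratio_mul_lt_one hGw hgap) hD1)
    -- A piece of `G₃` has lost less than `2 ^ -(k + 7)` of its indices in each of `[q, m)` and `[m,
    -- n)`. These two losses explain the factor `2 * N + 1` in the invariant.
    obtain ⟨z, hz, hzs, hzG⟩ := ih (s.erase e₀) G₃ n (splice m (splice q a z₁) z₂)
      (by rw [Finset.card_erase_of_mem he₀]; omega)
      (fun e he => hsT e (Finset.mem_of_mem_erase he))
      (fun e he => by
        have h2 := hsq e (Finset.mem_of_mem_erase he)
        have h3 := hlow e (Finset.mem_of_mem_erase he)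
        have h4 := card_below_add_card_above t (above q e.idx)
        have h5 : (above t (above q e.idx)).card ≤ (above n e.idx).card := by
          apply Finset.card_le_card
          intro i hi
          simp only [above, Finset.mem_filter] at hi ⊢
          exact ⟨hi.1.1, hn.2.trans hi.2⟩
        have h6 : (below t (above q e.idx)).card ≤ 2 ^ (k + 14) := h3
        rw [Nat.succ_mul] at h2
        omega)
      (fun e he => hG e (hsub₃ he)) (fun e he => hG0 e (hsub₃ he))
      (fun e he => by
        obtain ⟨heG, hn1, hn2⟩ := Finset.mem_filter.1 he
        have h2 := hGq e heG
        have h3 : 2 ^ (k + 7) * (between q m e.idx).card < e.idx.card := by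
          by_contra! h
          exact hn1 (Finset.mem_filter.2 ⟨heG, h⟩)
        have h4 : 2 ^ (k + 7) * (between m n e.idx).card < e.idx.card := by
          by_contra! h
          exact hn2 (Finset.mem_filter.2 ⟨heG, h⟩)
        rw [card_above_eq hqm hmn.le, Nat.mul_add (2 ^ (k + 7)), Nat.mul_add (2 ^ (k + 7)),
          show 2 * (N + 1) + 1 = 2 * N + 1 + 2 by ring, Nat.add_mul (2 * N + 1)] at h2
        omega)
      (hsub G₃ hsub₃)
    have hzm : ∀ i < m, z i = splice q a z₁ i := fun i hi => by
      rw [hz i (hi.trans hmn), splice_of_lt hi]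
    have hzq : ∀ i < q, z i = a i := fun i hi => by
      rw [hzm i (hi.trans_le hqm), splice_of_lt hi]
    have hz1' : ∀ e ∈ G₁, z ∉ e.carrier := fun e he hze => by
      refine hz₁ e he ⟨splice m z₁ z, ?_, fun i hi => (splice_of_lt hi _ _).symm⟩
      rw [Set.mem_ofPred_eq, splice_splice_of_le hqm, splice_eq_self hzm]
      exact hze
    have hz2' : ∀ e ∈ G₂, z ∉ e.carrier := fun e he hze => by
      refine hz₂ e he ⟨splice m z₂ z, ?_, fun i hi => ?_⟩
      · rw [Set.mem_ofPred_eq, splice_splice_self, splice_eq_self hzm]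
        exact hze
      · by_cases him : i < m
        · rw [splice_of_lt him]
        · rw [splice_of_le (not_lt.1 him), hz i hi, splice_of_le (not_lt.1 him)]
    refine ⟨z, hzq, fun e he => ?_, fun e he hze => ?_⟩
    · by_cases hee : e = e₀
      · subst hee
        intro hze
        refine hDX (splice m z₂ z) (hD (fun i hi => ?_) hz₂D) ?_
        · by_cases him : i < m
          · rw [splice_of_lt him]
          · rw [splice_of_le (not_lt.1 him), hz i hi, splice_of_le (not_lt.1 him)]
        · rw [splice_splice_self, splice_eq_self hzm]
          exact hze
      · exact hzs e (Finset.mem_erase.2 ⟨hee, he⟩)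
    · by_cases h1 : e ∈ G₁
      · exact hz1' e h1 hze
      by_cases h2 : e ∈ G₂
      · exact hz2' e h2 hze
      exact hzG e (Finset.mem_filter.2 ⟨he, h1, h2⟩) hze

lemma minCard_le_of_cost_lt {e : Piece α} (h : e.cost < 32) : minCard e.kind ≤ e.idx.card := by
  by_contra! hlt
  exact h.not_ge (le_weight_of_lt_minCard hlt)

/-- Each piece of type `k` costs at least `2⁻ᵏ`, whatever its index set. -/
lemma card_le_of_sum_cost_lt {s : Finset (Piece α)} (hs : ∀ e ∈ s, e.kind = k)
    (h : ∑ e ∈ s, e.cost < 32) : s.card ≤ 2 ^ (k + 5) := by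
  have h1 : (s.card : ℝ≥0∞) * 2⁻¹ ^ k ≤ ∑ e ∈ s, e.cost := by
    rw [← nsmul_eq_mul]
    apply Finset.card_nsmul_le_sum
    intro e he
    rw [← hs e he]
    exact half_pow_le_weight _ _
  have h2 : (s.card : ℝ≥0∞) ≤ 2 ^ (k + 5) := by
    have h3 := h1.trans h.le
    rw [← ENNReal.inv_pow, ← div_eq_mul_inv, ENNReal.div_le_iff (by simp) (by simp)] at h3
    refine h3.trans_eq ?_
    rw [pow_add, mul_comm]
    norm_num
  exact_mod_cast h2

/-- The whole space cannot be covered cheaply. -/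
theorem massBound_le_pre_univ [∀ n, Nonempty (α n)] (hk : k ≤ p) :
    ENNReal.ofReal (massBound k) ≤ pre p k (Set.univ : Set (∀ n, α n)) := by
  classical
  have a : ∀ n, α n := fun n => Classical.arbitrary _
  induction hk using Nat.decreasingInduction with
  | self =>
    -- No type is available, so the nonempty space has no covering and its value is infinite.
    refine le_cov fun F hF hB => ?_
    obtain ⟨e, he, -⟩ := hB a trivial
    have := mem_family.1 (hF he)
    omega
  | of_succ k hk ih =>
    by_contra! hlt
    obtain ⟨F, hF, hcov, hw⟩ := exists_cover_of_cov_lt hlt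
    have h32 : ENNReal.ofReal (massBound k) ≤ 32 := by
      simpa using ENNReal.ofReal_le_ofReal (massBound_le k)
    have hmem : ∀ e ∈ F, e ∈ family α p k := fun e he => hF he
    have hcard : ∀ e ∈ F, minCard e.kind ≤ e.idx.card := fun e he =>
      minCard_le_of_cost_lt (((Finset.single_le_sum (fun _ _ => zero_le) he).trans_lt hw).trans_le
        h32)
    set s := F.filter fun e => e.kind = k with hs
    set G := F.filter fun e => e.kind ≠ k with hG
    have hsF : s ⊆ F := Finset.filter_subset _ _
    have hGF : G ⊆ F := Finset.filter_subset _ _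
    have hsub : ∀ H ⊆ F, ∑ e ∈ H, e.cost < ENNReal.ofReal (massBound k) := fun H hH =>
      (Finset.sum_le_sum_of_subset hH).trans_lt hw
    have hscard : s.card ≤ 2 ^ (k + 5) :=
      card_le_of_sum_cost_lt (fun e he => (Finset.mem_filter.1 he).2)
        ((hsub s hsF).trans_le h32)
    have habove : ∀ I : Finset ℕ, above 0 I = I := fun I => by simp [above]
    obtain ⟨z, -, hzs, hzG⟩ := exists_avoiding ih s.card s G 0 a rfl
      (fun e he => by
        have := (mem_family.1 (hmem e (hsF he))).2.2
        rwa [(Finset.mem_filter.1 he).2] at this)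
      (fun e he => by
        rw [habove]
        refine le_trans ?_ (hcard e (hsF he))
        rw [(Finset.mem_filter.1 he).2]
        -- This is the constraint that fixes `minCard`: up to `2 ^ (k + 5)` rounds consuming `2 ^ (k
        -- + 14)` indices each.
        calc s.card * 2 ^ (k + 14) + 1 ≤ 2 ^ (k + 5) * 2 ^ (k + 14) + 2 ^ (k + 5) * 2 ^ (k + 14) :=
              add_le_add (Nat.mul_le_mul_right _ hscard) (Nat.one_le_iff_ne_zero.2 (by positivity))
          _ = minCard k := by unfold minCard; ring)
      (fun e he => by
        have h1 := mem_family.1 (hmem e (hGF he))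
        have h2 := (Finset.mem_filter.1 he).2
        exact mem_family.2 ⟨by omega, h1.2⟩)
      (fun e he => lt_of_lt_of_le (by unfold minCard; positivity) (hcard e (hGF he)))
      (fun e he => by
        rw [habove]
        apply Nat.mul_le_mul_right
        have : (2 : ℕ) ^ (k + 7) = 4 * 2 ^ (k + 5) := by ring
        have : 0 < (2 : ℕ) ^ (k + 5) := by positivity
        omega)
      (hsub G hGF)
    obtain ⟨e, he, hze⟩ := hcov z trivial
    by_cases hek : e.kind = k
    · exact hzs e (Finset.mem_filter.2 ⟨he, hek⟩) hze
    · exact hzG e (Finset.mem_filter.2 ⟨he, hek⟩) hze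

lemma sixteen_le_pre_univ [∀ n, Nonempty (α n)] (hk : k ≤ p) :
    16 ≤ pre p k (Set.univ : Set (∀ n, α n)) := by
  refine le_trans ?_ (massBound_le_pre_univ hk)
  simpa using ENNReal.ofReal_le_ofReal (le_massBound k)

end

/-! ### Large and small sets at a finite cut-off -/

section

variable {α : ℕ → Type*} {p k : ℕ}

/-- The element removed is the largest one not exceeding `n`; it separates the remaining ones on the
two sides of `n`. -/
lemma exists_subset_separated (I : Finset ℕ) (n : ℕ) : ∃ J ⊆ I, I.card ≤ J.card + 1 ∧
    ∀ m ∈ J, ∀ l ∈ J, m ≤ n → n < l → ∃ M ∈ I, m < M ∧ M ≤ n := by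
  classical
  by_cases h : (below (n + 1) I).Nonempty
  · set M := (below (n + 1) I).max' h
    have hM : M ∈ below (n + 1) I := Finset.max'_mem _ h
    obtain ⟨hMI, hMn⟩ := Finset.mem_filter.1 hM
    refine ⟨I.erase M, Finset.erase_subset _ _, ?_, fun m hm l hl hmn hnl => ?_⟩
    · rw [Finset.card_erase_of_mem hMI]; omega
    · refine ⟨M, hMI, lt_of_le_of_ne ?_ (Finset.ne_of_mem_erase hm), by omega⟩
      exact Finset.le_max' _ _ (Finset.mem_filter.2 ⟨Finset.mem_of_mem_erase hm, by omega⟩)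
  · refine ⟨I, subset_rfl, Nat.le_succ _, fun m hm l hl hmn hnl => ?_⟩
    exact absurd ⟨m, Finset.mem_filter.2 ⟨hm, by omega⟩⟩ h

lemma splice_update_of_le {m n : ℕ} (h : m ≤ n) (a z : ∀ n, α n) (τ : α n) :
    splice m a (Function.update z n τ) = Function.update (splice m a z) n τ := by
  funext i
  by_cases hi : i = n
  · subst hi
    rw [splice_of_le h]; simp
  · simp only [splice, Function.update_of_ne hi]

lemma splice_update_of_lt {m n : ℕ} (h : n < m) (a z : ∀ n, α n) (τ : α n) :
    splice m (Function.update a n τ) z = Function.update (splice m a z) n τ := by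
  funext i
  by_cases hi : i = n
  · subst hi
    rw [splice_of_lt h]; simp
  · simp only [splice, Function.update_of_ne hi]

/-- Only pairs of levels around the coordinate `n` are problematic. For these, a witness of rank `M
≤ n` does not see that coordinate; the separating level `M` is the index given up. -/
lemma Thin.update {ν : Set (∀ n, α n) → ℝ≥0∞} {I : Finset ℕ} {X : Set (∀ n, α n)}
    (h : Thin ν I X) (n : ℕ) (τ : α n) :
    ∃ J ⊆ I, I.card ≤ J.card + 1 ∧ Thin ν J {z | Function.update z n τ ∈ X} := by
  obtain ⟨J, hJI, hcard, hJ⟩ := exists_subset_separated I n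
  refine ⟨J, hJI, hcard, fun m hm l hl hml a => ?_⟩
  rcases lt_or_ge n m with hnm | hmn
  · obtain ⟨D, hD, hD1, hDX⟩ := h m (hJI hm) l (hJI hl) hml (Function.update a n τ)
    refine ⟨D, hD, hD1, fun z hz hzX => hDX z hz ?_⟩
    rwa [splice_update_of_lt hnm]
  · have key : ∃ M ∈ I, m < M ∧ M ≤ n ∧ M ≤ l := by
      rcases lt_or_ge n l with hnl | hln
      · obtain ⟨M, hM, hmM, hMn⟩ := hJ m hm l hl hmn hnl
        exact ⟨M, hM, hmM, hMn, hMn.trans hnl.le⟩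
      · exact ⟨l, hJI hl, hml, hln, le_rfl⟩
    obtain ⟨M, hM, hmM, hMn, hMl⟩ := key
    obtain ⟨D, hD, hD1, hDX⟩ := h m (hJI hm) M hM hmM a
    refine ⟨D, hD.mono hMl, hD1, fun z hz hzX => hDX (Function.update z n τ) (hD ?_ hz) ?_⟩
    · intro i hi
      rw [Function.update_of_ne (by omega)]
    · rwa [splice_update_of_le hmn]

lemma cost_lt_of_sum_lt {F : Finset (Piece α)} {c : ℝ≥0∞} (h : ∑ e ∈ F, e.cost < c) {e : Piece α}
    (he : e ∈ F) : e.cost < c :=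
  (Finset.single_le_sum (fun _ _ => zero_le) he).trans_lt h

lemma two_le_minCard (k : ℕ) : 2 ≤ minCard k := by
  unfold minCard
  calc 2 = 2 ^ 1 := by norm_num
    _ ≤ _ := Nat.pow_le_pow_right (by norm_num) (by omega)

/-- If modifications of the pieces of a covering are admissible and keep half of the indices,
they give a covering that is at most twice as expensive. -/
lemma pre_le_two_mul_sum {ι : Type*} (F : Finset ι) (f : ι → Piece α)
    (hF : ∀ i ∈ F, f i ∈ family α p k)
    (J : ι → Finset ℕ) (hJ : ∀ i ∈ F, (f i).idx.card ≤ 2 * (J i).card) (X : ι → Set (∀ n, α n))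
    (hX : ∀ i ∈ F, Thin (pre p ((f i).kind + 1)) (J i) (X i)) {B : Set (∀ n, α n)}
    (hB : ∀ z ∈ B, ∃ i ∈ F, z ∈ X i) : pre p k B ≤ 2 * ∑ i ∈ F, (f i).cost := by
  calc pre p k B ≤ ∑ i ∈ F, (⟨(f i).kind, J i, X i⟩ : Piece α).cost :=
        cov_le_sum F _ (fun i hi => family_trunc (hF i hi) (hX i hi)) hB
    _ ≤ ∑ i ∈ F, 2 * (f i).cost :=
        Finset.sum_le_sum fun i hi => weight_le_two_mul (hJ i hi)
    _ = _ := (Finset.mul_sum _ _ _).symm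

lemma two_mul_lt_sixteen {x : ℝ≥0∞} (h : x < 8) : 2 * x < 16 :=
  calc 2 * x < 2 * 8 := (ENNReal.mul_lt_mul_iff_right (by simp) (by simp)).2 h
    _ = 16 := by norm_num

/-- Overwriting the coordinate by `τ` turns a covering of this set into a covering of the whole
space at no more than twice the cost. -/
lemma one_le_pre_coordinate [∀ n, Nonempty (α n)] (hk : k ≤ p) (n : ℕ) (τ : α n) :
    1 ≤ pre p k {z | z n = τ} := by
  by_contra! hlt
  have hlt8 : pre p k {z : ∀ n, α n | z n = τ} < 8 := hlt.trans (by norm_num)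
  obtain ⟨F, hF, hcov, hw⟩ := exists_cover_of_cov_lt hlt8
  have h : ∀ e ∈ F, ∃ J : Finset ℕ, e.idx.card ≤ 2 * J.card ∧
      Thin (pre p (e.kind + 1)) J {z | Function.update z n τ ∈ e.carrier} := by
    intro e he
    obtain ⟨J, -, hJ, hT⟩ := (mem_family.1 (hF he)).2.2.update n τ
    have h1 := minCard_le_of_cost_lt ((cost_lt_of_sum_lt hw he).trans (by norm_num))
    have h2 := two_le_minCard e.kind
    exact ⟨J, by omega, hT⟩
  choose! J hJ hT using h
  have h1 := pre_le_two_mul_sum F id (fun e he => hF he) J hJ _ hT (B := Set.univ)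
    (fun z _ => hcov (Function.update z n τ) (by simp))
  exact ((sixteen_le_pre_univ hk).trans h1).not_gt (two_mul_lt_sixteen hw)

lemma pre_preimage_le (σ : ∀ i, Equiv.Perm (α i)) (B : Set (∀ n, α n))
    (h : ∀ j, k < j → j ≤ p → ∀ B, pre p j ((fun (z : ∀ n, α n) i => σ i (z i)) ⁻¹' B) = pre p j B) :
    pre p k ((fun z i => σ i (z i)) ⁻¹' B) ≤ pre p k B := by
  refine le_cov fun F hF hB => ?_
  refine cov_le_sum F (fun e => ⟨e.kind, e.idx, (fun z i => σ i (z i)) ⁻¹' e.carrier⟩)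
    (fun e he => ?_) (fun z hz => hB _ hz)
  have hm := mem_family.1 (hF he)
  exact family_trunc (hF he) (hm.2.2.preimage _ (h _ (Nat.lt_succ_of_le hm.1) hm.2.1))

/-- The submeasures are invariant under coordinatewise permutations. -/
theorem pre_preimage (d : ℕ) : ∀ k, p ≤ k + d → ∀ (σ : ∀ i, Equiv.Perm (α i))
    (B : Set (∀ n, α n)), pre p k ((fun z i => σ i (z i)) ⁻¹' B) = pre p k B := by
  induction d with
  | zero => ?_
  | succ d ih => ?_
  all_goals
    intro k hk σ B
    have key : ∀ (τ : ∀ i, Equiv.Perm (α i)) (B : Set (∀ n, α n)),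
        pre p k ((fun z i => τ i (z i)) ⁻¹' B) ≤ pre p k B := fun τ B =>
      pre_preimage_le τ B fun j hj hjp => by first | exact ih j (by omega) τ | omega
    refine le_antisymm (key σ B) ?_
    have h1 := key (fun i => (σ i).symm) ((fun z i => σ i (z i)) ⁻¹' B)
    have h2 : (fun (z : ∀ n, α n) i => (σ i).symm (z i)) ⁻¹' ((fun z i => σ i (z i)) ⁻¹' B) =
        B := by
      ext z
      simp
    rwa [h2] at h1

/-- A point outside of the traces of the pieces that have half of their indices below `q` can be
modified beyond `q` so as to avoid all pieces of a cheap family. -/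
lemma exists_agree_not_mem [∀ n, Nonempty (α n)] (hk : k ≤ p) {F : Finset (Piece α)}
    (hF : ↑F ⊆ family α p k) (hw : ∑ e ∈ F, e.cost < 8) (q : ℕ) (a : ∀ n, α n)
    (ha : ∀ e ∈ F, e.idx.card ≤ 2 * (below q e.idx).card → a ∉ hull q e.carrier) :
    ∃ z, (∀ i < q, z i = a i) ∧ ∀ e ∈ F, z ∉ e.carrier := by
  classical
  by_contra! hcov
  set G := F.filter fun e => ¬ e.idx.card ≤ 2 * (below q e.idx).card with hG
  have hGF : G ⊆ F := Finset.filter_subset _ _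
  have h1 := pre_le_two_mul_sum G id (fun e he => hF (hGF he)) (fun e => above q e.idx)
    (fun e he => by
      have h1 := (Finset.mem_filter.1 he).2
      have h2 := card_below_add_card_above q e.idx
      simp only [id]
      omega)
    (fun e => {z | splice q a z ∈ e.carrier})
    (fun e he => ((mem_family.1 (hF (hGF he))).2.2.subset (Finset.filter_subset _ _)).pullback
        (fun i hi => (Finset.mem_filter.1 hi).2) a) (B := Set.univ)
    (fun z _ => by
      obtain ⟨e, he, hze⟩ := hcov (splice q a z) fun i hi => splice_of_lt hi a z
      refine ⟨e, Finset.mem_filter.2 ⟨he, fun hle => ha e he hle ⟨_, hze, fun i hi => ?_⟩⟩, hze⟩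
      exact (splice_of_lt hi a z).symm)
  exact ((sixteen_le_pre_univ hk).trans h1).not_gt
    (two_mul_lt_sixteen ((Finset.sum_le_sum_of_subset hGF).trans_lt hw))

lemma minCard_mono {j l : ℕ} (h : j ≤ l) : minCard j ≤ minCard l :=
  Nat.pow_le_pow_right (by norm_num) (by omega)

lemma lt_minCard (n : ℕ) : 2 * n < minCard n := by
  unfold minCard
  calc 2 * n < 2 * 2 ^ n := by
        have := Nat.lt_two_pow_self (n := n)
        omega
    _ = 2 ^ (n + 1) := by ring
    _ ≤ _ := Nat.pow_le_pow_right (by norm_num) (by omega)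

lemma card_below_le (n : ℕ) (J : Finset ℕ) : (below n J).card ≤ n := by
  calc (below n J).card ≤ (Finset.range n).card := Finset.card_le_card fun i hi =>
        Finset.mem_range.2 (Finset.mem_filter.1 hi).2
    _ = n := Finset.card_range n

/-- Pieces cheaper than `2⁻ᵐ` have type at least `m`, hence more than `2 * m` indices, at least half
of which lie above `m`. -/
lemma pre_pullback_le {m : ℕ} {Q : Set (∀ n, α n)} {c : ℝ≥0∞} (hc : c ≤ 2⁻¹ ^ m)
    (hQ : pre p k Q < c) (a : ∀ n, α n) : pre p k {z | splice m a z ∈ Q} ≤ 2 * c := by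
  obtain ⟨F, hF, hcov, hw⟩ := exists_cover_of_cov_lt hQ
  have hle : c ≤ 1 := hc.trans (pow_le_one₀ zero_le (by simp))
  refine (pre_le_two_mul_sum F id (fun e he => hF he) (fun e => above m e.idx) (fun e he => ?_)
    (fun e => {z | splice m a z ∈ e.carrier})
    (fun e he => ((mem_family.1 (hF he)).2.2.subset (Finset.filter_subset _ _)).pullback
        (fun i hi => (Finset.mem_filter.1 hi).2) a) (fun z hz => hcov _ hz)).trans ?_
  · have hcost := cost_lt_of_sum_lt hw he
    have h1 := minCard_le_of_cost_lt ((hcost.trans_le hle).trans (by norm_num))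
    have hkind : m ≤ e.kind := by
      by_contra! hlt
      refine ((half_pow_le_weight e.kind e.idx.card).trans_lt (hcost.trans_le hc)).not_ge ?_
      exact pow_le_pow_of_le_one zero_le (by simp) hlt.le
    have h2 := minCard_mono hkind
    have h3 := lt_minCard m
    have h4 := card_below_add_card_above m e.idx
    have h5 := card_below_le m e.idx
    simp only [id]
    omega
  · gcongr
    exact hw.le

lemma pre_le_half_pow {I : Finset ℕ} {X : Set (∀ n, α n)} (hk : k < p)
    (hX : Thin (pre p (k + 1)) I X) (hI : I.card = maxCard k) : pre p k X ≤ 2⁻¹ ^ k := by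
  refine (cov_le_cost (e := ⟨k, I, X⟩) (mem_family.2 ⟨le_rfl, hk, hX⟩) subset_rfl).trans ?_
  rw [← weight_maxCard k, ← hI]
  exact le_rfl

/-- For `m < n` in `I`, the witness of thinness is the set where coordinate `m` takes its forbidden
value. -/
lemma pre_avoid_le [∀ n, Nonempty (α n)] (hk : k < p) {I : Finset ℕ} (hI : I.card = maxCard k)
    (τ : ∀ n, α n) : pre p k {z | ∀ n ∈ I, z n ≠ τ n} ≤ 2⁻¹ ^ k := by
  refine pre_le_half_pow hk (fun m hm n hn hmn a => ?_) hI
  refine ⟨{z | z m = τ m}, fun z y hzy hz => ?_, one_le_pre_coordinate hk m (τ m),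
    fun z hz hzX => hzX m hm ?_⟩
  · exact (hzy m hmn).symm.trans hz
  · rw [splice_of_le le_rfl]
    exact hz

/-- Along the empty index set every set is thin. The `n + 1` in the weight keeps its cost finite. -/
lemma pre_univ_le (hk : k < p) : pre p k (Set.univ : Set (∀ n, α n)) ≤ weight k 0 :=
  cov_le_cost (e := ⟨k, ∅, Set.univ⟩)
    (mem_family.2 ⟨le_rfl, hk, fun m hm => absurd hm (Finset.notMem_empty m)⟩) subset_rfl

end

/-! ### Limits along an ultrafilter -/

section Ultralimit

/-- The limit of a sequence of extended nonnegative reals along a fixed nonprincipal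
ultrafilter. -/
noncomputable def ulim (f : ℕ → ℝ≥0∞) : ℝ≥0∞ := ((hyperfilter ℕ).map f).lim

lemma tendsto_ulim (f : ℕ → ℝ≥0∞) : Tendsto f (hyperfilter ℕ) (𝓝 (ulim f)) :=
  Ultrafilter.le_nhds_lim ((hyperfilter ℕ).map f)

lemma eventually_ge_hyperfilter (n : ℕ) : ∀ᶠ p in (hyperfilter ℕ : Filter ℕ), n ≤ p := by
  have : (hyperfilter ℕ : Filter ℕ) ≤ atTop := by
    rw [← Nat.cofinite_eq_atTop]
    exact hyperfilter_le_cofinite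
  exact this (eventually_ge_atTop n)

lemma ulim_le {f : ℕ → ℝ≥0∞} {c : ℝ≥0∞} (h : ∀ᶠ p in (hyperfilter ℕ : Filter ℕ), f p ≤ c) :
    ulim f ≤ c := le_of_tendsto (tendsto_ulim f) h

lemma le_ulim {f : ℕ → ℝ≥0∞} {c : ℝ≥0∞} (h : ∀ᶠ p in (hyperfilter ℕ : Filter ℕ), c ≤ f p) :
    c ≤ ulim f := ge_of_tendsto (tendsto_ulim f) h

lemma ulim_mono {f g : ℕ → ℝ≥0∞} (h : ∀ᶠ p in (hyperfilter ℕ : Filter ℕ), f p ≤ g p) :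
    ulim f ≤ ulim g := le_of_tendsto_of_tendsto (tendsto_ulim f) (tendsto_ulim g) h

lemma eventually_lt_of_ulim_lt {f : ℕ → ℝ≥0∞} {c : ℝ≥0∞} (h : ulim f < c) :
    ∀ᶠ p in (hyperfilter ℕ : Filter ℕ), f p < c := (tendsto_ulim f).eventually_lt_const h

lemma eventually_lt_of_lt_ulim {f : ℕ → ℝ≥0∞} {c : ℝ≥0∞} (h : c < ulim f) :
    ∀ᶠ p in (hyperfilter ℕ : Filter ℕ), c < f p := (tendsto_ulim f).eventually_const_lt h

lemma exists_eventually_eq {β : Type*} (U : Ultrafilter ℕ) {S : Set β} (hS : S.Finite) {f : ℕ → β}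
    (hf : ∀ p, f p ∈ S) : ∃ c ∈ S, ∀ᶠ p in (U : Filter ℕ), f p = c := by
  have h : (⋃ c ∈ S, {p | f p = c}) ∈ U := by
    filter_upwards with p
    exact Set.mem_biUnion (hf p) rfl
  exact (Ultrafilter.finite_biUnion_mem_iff hS).1 h

end Ultralimit

/-! ### Finiteness of the cylinders of a given rank -/

section FiniteRank

variable {α : ℕ → Type*}

/-- Finitely many points represent all cylinders of a given rank. -/
lemma exists_representatives [∀ n, Finite (α n)] [∀ n, Nonempty (α n)] (n : ℕ) :
    ∃ R : Finset (∀ n, α n), ∀ z : ∀ n, α n, ∃ b ∈ R, ∀ i < n, z i = b i := by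
  classical
  let z₀ : ∀ n, α n := fun n => Classical.arbitrary _
  have hfin : (Set.range fun (f : ∀ i : Fin n, α i) (i : ℕ) =>
      if h : i < n then f ⟨i, h⟩ else z₀ i).Finite := Set.finite_range _
  refine ⟨hfin.toFinset, fun z => ⟨_, hfin.mem_toFinset.2 ⟨fun i => z i, rfl⟩, fun i hi => ?_⟩⟩
  simp [hi]

lemma finite_setOf_isCyl [∀ n, Finite (α n)] [∀ n, Nonempty (α n)] (n : ℕ) :
    {D : Set (∀ n, α n) | IsCyl n D}.Finite := by
  classical
  obtain ⟨R, hR⟩ := exists_representatives (α := α) n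
  refine Set.Finite.of_finite_image (f := fun D => R.filter (· ∈ D))
    (R.powerset.finite_toSet.subset ?_) ?_
  · rintro _ ⟨D, -, rfl⟩
    exact Finset.mem_coe.2 (Finset.mem_powerset.2 (Finset.filter_subset _ _))
  · have key : ∀ D E : Set (∀ n, α n), IsCyl n D → IsCyl n E →
        R.filter (· ∈ D) = R.filter (· ∈ E) → D ⊆ E := by
      intro D E hD hE h z hz
      obtain ⟨b, hb, hzb⟩ := hR z
      have h1 : b ∈ R.filter (· ∈ E) := h ▸ Finset.mem_filter.2 ⟨hb, hD hzb hz⟩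
      exact hE (fun i hi => (hzb i hi).symm) (Finset.mem_filter.1 h1).2
    exact fun D hD E hE h => (key D E hD hE h).antisymm (key E D hE hD h.symm)

end FiniteRank

/-! ### The limit submeasures -/

section Limit

variable {α : ℕ → Type*}

/-- The limit of the submeasures built from pieces of types `k, …, p - 1` as `p` grows. -/
noncomputable def limSub (k : ℕ) (B : Set (∀ n, α n)) : ℝ≥0∞ := ulim fun p => pre p k B

variable {k : ℕ} {A B : Set (∀ n, α n)}

lemma limSub_mono (h : A ⊆ B) : limSub k A ≤ limSub k B :=
  ulim_mono (Eventually.of_forall fun _ => cov_mono h)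

lemma limSub_mono_index {l : ℕ} (h : k ≤ l) (B : Set (∀ n, α n)) : limSub k B ≤ limSub l B :=
  ulim_mono (Eventually.of_forall fun _ => pre_mono_index h B)

lemma limSub_empty : limSub k (∅ : Set (∀ n, α n)) = 0 :=
  le_antisymm (ulim_le (Eventually.of_forall fun _ => cov_empty.le)) zero_le

lemma limSub_le_sum {ι : Type*} (s : Finset ι) (A : ι → Set (∀ n, α n))
    (hB : ∀ z ∈ B, ∃ i ∈ s, z ∈ A i) : limSub k B ≤ ∑ i ∈ s, limSub k (A i) :=
  le_of_tendsto_of_tendsto (tendsto_ulim _) (tendsto_finsetSum s fun _ _ => tendsto_ulim _)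
    (Eventually.of_forall fun _ => cov_le_sum_cov s A hB)

lemma limSub_union_le (A B : Set (∀ n, α n)) : limSub k (A ∪ B) ≤ limSub k A + limSub k B :=
  le_of_tendsto_of_tendsto (tendsto_ulim _) ((tendsto_ulim _).add (tendsto_ulim _))
    (Eventually.of_forall fun _ => cov_union_le A B)

lemma limSub_univ_ne_top : limSub k (Set.univ : Set (∀ n, α n)) ≠ ∞ := by
  refine ne_top_of_le_ne_top (weight_ne_top k 0) (ulim_le ?_)
  filter_upwards [eventually_ge_hyperfilter (k + 1)] with p hp
  exact pre_univ_le hp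

lemma limSub_preimage (σ : ∀ i, Equiv.Perm (α i)) (B : Set (∀ n, α n)) :
    limSub k ((fun z i => σ i (z i)) ⁻¹' B) = limSub k B := by
  unfold limSub
  congr 1
  funext p
  exact pre_preimage p k (Nat.le_add_left p k) σ B

lemma limSub_pullback_le {m : ℕ} {Q : Set (∀ n, α n)} {c : ℝ≥0∞} (hc : c ≤ 2⁻¹ ^ m)
    (hQ : limSub k Q < c) (a : ∀ n, α n) : limSub k {z | splice m a z ∈ Q} ≤ 2 * c := by
  apply ulim_le
  filter_upwards [eventually_lt_of_ulim_lt hQ] with p hp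
  exact pre_pullback_le hc hp a

variable [∀ n, Nonempty (α n)]

lemma one_le_limSub_coordinate (n : ℕ) (τ : α n) : 1 ≤ limSub k {z | z n = τ} := by
  apply le_ulim
  filter_upwards [eventually_ge_hyperfilter k] with p hp
  exact one_le_pre_coordinate hp n τ

lemma sixteen_le_limSub_univ : 16 ≤ limSub k (Set.univ : Set (∀ n, α n)) := by
  apply le_ulim
  filter_upwards [eventually_ge_hyperfilter k] with p hp
  exact sixteen_le_pre_univ hp

lemma limSub_avoid_le {I : Finset ℕ} (hI : I.card = maxCard k) (τ : ∀ n, α n) :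
    limSub k {z | ∀ n ∈ I, z n ≠ τ n} ≤ 2⁻¹ ^ k := by
  apply ulim_le
  filter_upwards [eventually_ge_hyperfilter (k + 1)] with p hp
  exact pre_avoid_le hp hI τ

variable [∀ n, Finite (α n)]

/-- Halving asks for witnesses of limit value at least `2`, so that they exceed `1` eventually in
`p`. Finitely many base points suffice, since only their first `m` coordinates matter. -/
lemma eventually_thin_pre {I : Finset ℕ} {X : Set (∀ n, α n)}
    (h : Thin (fun B => limSub k B / 2) I X) :
    ∀ᶠ p in (hyperfilter ℕ : Filter ℕ), Thin (pre p k) I X := by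
  simp only [Thin]
  refine (eventually_all_finset I).2 fun m hm => (eventually_all_finset I).2 fun n hn => ?_
  by_cases hmn : m < n
  swap
  · exact Eventually.of_forall fun p hlt => absurd hlt hmn
  obtain ⟨R, hR⟩ := exists_representatives (α := α) m
  choose D hD hD1 hDX using h m hm n hn hmn
  have h1 : ∀ᶠ p in (hyperfilter ℕ : Filter ℕ), ∀ b ∈ R, 1 < pre p k (D b) := by
    refine (eventually_all_finset R).2 fun b _ => eventually_lt_of_lt_ulim ?_
    have h2 : 1 * 2 ≤ limSub k (D b) :=
      (ENNReal.le_div_iff_mul_le (by simp) (by simp)).1 (hD1 b)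
    exact lt_of_lt_of_le (by norm_num) h2
  filter_upwards [h1] with p hp _ a
  obtain ⟨b, hb, hab⟩ := hR a
  refine ⟨D b, hD b, (hp b hb).le, fun z hz hzX => hDX b z hz ?_⟩
  convert hzX using 1
  funext i
  by_cases hi : i < m
  · rw [splice_of_lt hi, splice_of_lt hi, hab i hi]
  · rw [splice_of_le (not_lt.1 hi), splice_of_le (not_lt.1 hi)]

lemma limSub_le_half_pow {I : Finset ℕ} {X : Set (∀ n, α n)}
    (hX : Thin (fun B => limSub (k + 1) B / 2) I X) (hI : I.card = maxCard k) :
    limSub k X ≤ 2⁻¹ ^ k := by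
  apply ulim_le
  filter_upwards [eventually_ge_hyperfilter (k + 1), eventually_thin_pre hX] with p hp hT
  exact pre_le_half_pow hp hT hI

end Limit

/-! ### Pieces concentrated on initial segments -/

section Concentrated

variable {α : ℕ → Type*}

open Classical in
/-- The pieces of type `j` in `F` that have at least half of their indices below `n`. -/
noncomputable def concentrated (F : Finset (Piece α)) (j n : ℕ) : Finset (Piece α) :=
  F.filter fun e => e.kind = j ∧ e.idx.card ≤ 2 * (below n e.idx).card

lemma mem_concentrated {F : Finset (Piece α)} {j n : ℕ} {e : Piece α} :
    e ∈ concentrated F j n ↔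
      e ∈ F ∧ e.kind = j ∧ e.idx.card ≤ 2 * (below n e.idx).card := by
  simp [concentrated]

lemma below_mono {m n : ℕ} (h : m ≤ n) (J : Finset ℕ) : below m J ⊆ below n J := fun i hi => by
  simp only [below, Finset.mem_filter] at hi ⊢
  exact ⟨hi.1, hi.2.trans_le h⟩

lemma concentrated_mono (F : Finset (Piece α)) (j : ℕ) {m n : ℕ} (h : m ≤ n) :
    concentrated F j m ⊆ concentrated F j n := fun e he => by
  rw [mem_concentrated] at he ⊢
  refine ⟨he.1, he.2.1, he.2.2.trans ?_⟩
  exact Nat.mul_le_mul_left _ (Finset.card_le_card (below_mono h _))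

lemma sum_concentrated_le (F : Finset (Piece α)) (T : Finset ℕ) (n : ℕ → ℕ) :
    ∑ j ∈ T, ∑ e ∈ concentrated F j (n j), e.cost ≤ ∑ e ∈ F, e.cost := by
  classical
  rw [← Finset.sum_biUnion]
  · apply Finset.sum_le_sum_of_subset
    intro e he
    obtain ⟨j, -, hj⟩ := Finset.mem_biUnion.1 he
    exact (mem_concentrated.1 hj).1
  · intro i _ j _ hij
    rw [Function.onFun, Finset.disjoint_left]
    intro e hi hj
    exact hij ((mem_concentrated.1 hi).2.1.symm.trans (mem_concentrated.1 hj).2.1)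

/-- For a sequence of cheap families, the parts that are concentrated on initial segments
stabilize along an ultrafilter. -/
lemma exists_stable_rank (U : Ultrafilter ℕ) {F : ℕ → Finset (Piece α)}
    (hF : ∀ p, ∑ e ∈ F p, e.cost < 32) (j : ℕ) :
    ∃ N, ∀ n, ∀ᶠ p in (U : Filter ℕ), concentrated (F p) j n ⊆ concentrated (F p) j N := by
  have hcard : ∀ n p, (concentrated (F p) j n).card ∈ Set.Iic (2 ^ (j + 5)) := fun n p =>
    card_le_of_sum_cost_lt (fun e he => (mem_concentrated.1 he).2.1)
      ((Finset.sum_le_sum_of_subset fun e he => (mem_concentrated.1 he).1).trans_lt (hF p))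
  choose κ hκ hκU using fun n => exists_eventually_eq U (Set.finite_Iic (2 ^ (j + 5))) (hcard n)
  have hfin : (Set.range κ).Finite :=
    (Set.finite_Iic (2 ^ (j + 5))).subset (Set.range_subset_iff.2 hκ)
  -- The families increase with the rank and their eventual cardinalities `κ` are bounded, so they
  -- stop growing at a rank that maximises `κ`.
  obtain ⟨_, ⟨N, rfl⟩, hN⟩ := Set.exists_max_image _ id hfin (Set.range_nonempty κ)
  refine ⟨N, fun n => ?_⟩
  rcases le_total n N with h | h
  · exact Eventually.of_forall fun p => concentrated_mono _ _ h
  · filter_upwards [hκU n, hκU N] with p h1 h2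
    refine (Finset.eq_of_subset_of_card_le (concentrated_mono (F p) j h) ?_).symm.subset
    rw [h1, h2]
    exact hN _ ⟨n, rfl⟩

lemma exists_tail_sum_le {S : ℕ → ℝ≥0∞} {c : ℝ≥0∞} (hc : c ≠ ∞)
    (hS : ∀ T : Finset ℕ, ∑ j ∈ T, S j ≤ c)
    {η : ℝ≥0∞} (hη : 0 < η) : ∃ K, ∀ K', ∑ j ∈ Finset.Ico K K', S j ≤ η := by
  have h1 : ∑' j, S j ≠ ∞ := ne_top_of_le_ne_top hc (by
    rw [ENNReal.tsum_eq_iSup_sum]; exact iSup_le hS)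
  obtain ⟨K, hK⟩ := ((ENNReal.tendsto_sum_nat_add S h1).eventually_lt_const hη).exists
  refine ⟨K, fun K' => le_trans ?_ hK.le⟩
  rw [Finset.sum_Ico_eq_sum_range]
  simp_rw [add_comm K]
  exact ENNReal.sum_le_tsum _

end Concentrated

/-! ### Exhaustivity -/

section Exhaustive

variable {α : ℕ → Type*} {k : ℕ}

/-- The part of a covering that is concentrated below `n` and has small type is contained in a
cheap set of rank `n`. -/
lemma pre_biUnion_hull_le {p : ℕ} {F G : Finset (Piece α)} (hF : ↑F ⊆ family α p k) (hG : G ⊆ F)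
    {n : ℕ} (h : ∀ e ∈ G, e.idx.card ≤ 2 * (below n e.idx).card) {B : Set (∀ n, α n)}
    (hB : ∀ z ∈ B, ∃ e ∈ G, z ∈ hull n e.carrier) : pre p k B ≤ 2 * ∑ e ∈ G, e.cost :=
  pre_le_two_mul_sum G id (fun _ he => hF (hG he)) (fun e => below n e.idx) h _
    (fun _ he => ((mem_family.1 (hF (hG he))).2.2.subset (Finset.filter_subset _ _)).hull
      fun _ hi => (Finset.mem_filter.1 hi).2.le) hB

variable [∀ n, Nonempty (α n)] [∀ n, Finite (α n)]

/-- If the unions of finitely many terms of a sequence of sets of finite rank remain small, then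
there is a large set of finite rank on which all terms are very small. -/
lemma exists_large_cyl_of_small_unions {E : ℕ → Set (∀ n, α n)} (hE : ∀ j, ∃ n, IsCyl n (E j))
    (hsmall : ∀ s, limSub k (⋃ i ∈ Finset.range s, E i) < 2) {η : ℝ≥0∞} (hη : 0 < η) :
    ∃ n D, IsCyl n D ∧ 2 ≤ limSub k D ∧ ∀ j, limSub k (E j ∩ D) ≤ η := by
  classical
  set V : ℕ → Set (∀ n, α n) := fun s => ⋃ i ∈ Finset.range s, E i with hV
  -- Since `s p` grows without bound along the ultrafilter, the one cheap family `F p` eventually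
  -- covers each given `E i`.
  let s : ℕ → ℕ := fun p => Nat.findGreatest (fun s => pre p k (V s) < 2) p
  have hs : ∀ p, pre p k (V (s p)) < 2 := fun p => by
    refine Nat.findGreatest_spec (P := fun s => pre p k (V s) < 2) (m := 0) (Nat.zero_le p) ?_
    simp [V, pre, cov_empty]
  have hsU : ∀ i, ∀ᶠ p in (hyperfilter ℕ : Filter ℕ), i ≤ s p := fun i => by
    filter_upwards [eventually_ge_hyperfilter i, eventually_lt_of_ulim_lt (hsmall i)] with p h1 h2
    exact Nat.le_findGreatest h1 h2
  choose F hF hcov hw using fun p => exists_cover_of_cov_lt (hs p)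
  obtain ⟨N, hN⟩ := Classical.axiomOfChoice fun j =>
    exists_stable_rank (hyperfilter ℕ) (fun p => (hw p).trans (by norm_num)) j
  set S : ℕ → ℝ≥0∞ := fun j => ulim fun p => ∑ e ∈ concentrated (F p) j (N j), e.cost with hS
  have hSsum : ∀ T : Finset ℕ, ∑ j ∈ T, S j ≤ 2 := fun T =>
    le_of_tendsto (tendsto_finsetSum T fun _ _ => tendsto_ulim _)
      (Eventually.of_forall fun p => (sum_concentrated_le (F p) T N).trans (hw p).le)
  obtain ⟨K, hK⟩ := exists_tail_sum_le (by simp) hSsum (ENNReal.half_pos hη.ne')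
  -- Concentrated pieces of type below `K` have stabilised by rank `n` and are discarded with `W`;
  -- those of type at least `K` cost at most `η / 2` in the limit, doubled by truncation.
  set n := (Finset.range K).sup N with hn
  let G : ℕ → Finset (Piece α) := fun p => (F p).filter fun e =>
    e.kind < K ∧ e.idx.card ≤ 2 * (below n e.idx).card
  have hGF : ∀ p, G p ⊆ F p := fun p => Finset.filter_subset _ _
  obtain ⟨W, hW, hWU⟩ := exists_eventually_eq (hyperfilter ℕ) (finite_setOf_isCyl (α := α) n)
    (f := fun p => ⋃ e ∈ G p, hull n e.carrier)
    (fun p => isCyl_iUnion fun e => isCyl_iUnion fun _ => isCyl_hull n _)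
  refine ⟨n, Wᶜ, IsCyl.compl hW, le_ulim ?_, fun i => ?_⟩
  · filter_upwards [hWU, eventually_ge_hyperfilter k] with p hp hkp
    have h1 : pre p k W ≤ 4 := by
      refine (pre_biUnion_hull_le (hF p) (hGF p) (fun e he => (Finset.mem_filter.1 he).2.2)
        (fun z hz => ?_)).trans ?_
      · rw [← hp] at hz
        simpa only [Set.mem_iUnion, exists_prop] using hz
      · calc 2 * ∑ e ∈ G p, e.cost ≤ 2 * 2 := by
              gcongr
              exact (Finset.sum_le_sum_of_subset (hGF p)).trans (hw p).le
          _ = 4 := by norm_num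
    by_contra! hlt
    have h2 := (sixteen_le_pre_univ (α := α) hkp).trans ((cov_mono (by simp)).trans
      (cov_union_le (C := family α p k) W Wᶜ))
    refine (h2.trans (add_le_add h1 hlt.le)).not_gt (by norm_num)
  · obtain ⟨n₀, hn₀⟩ := hE i
    set m := max n n₀ with hm
    have hEm : IsCyl m (E i) := hn₀.mono (le_max_right _ _)
    have hlim : Tendsto (fun p => ∑ j ∈ Finset.Ico K m,
        2 * ∑ e ∈ concentrated (F p) j (N j), e.cost) (hyperfilter ℕ)
        (𝓝 (∑ j ∈ Finset.Ico K m, 2 * S j)) :=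
      tendsto_finsetSum _ fun _ _ => ENNReal.Tendsto.const_mul (tendsto_ulim _) (by simp)
    have hle : ∑ j ∈ Finset.Ico K m, 2 * S j ≤ η := by
      rw [← Finset.mul_sum]
      calc 2 * ∑ j ∈ Finset.Ico K m, S j ≤ 2 * (η / 2) := by
            gcongr
            exact hK m
        _ = η := ENNReal.mul_div_cancel (by simp) (by simp)
    refine le_trans (le_of_tendsto_of_tendsto (tendsto_ulim _) hlim ?_) hle
    have hstab : ∀ᶠ p in (hyperfilter ℕ : Filter ℕ), ∀ j ∈ Finset.range m,
        concentrated (F p) j m ⊆ concentrated (F p) j (N j) :=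
      (eventually_all_finset _).2 fun j _ => hN j m
    have hstab' : ∀ᶠ p in (hyperfilter ℕ : Filter ℕ), ∀ j ∈ Finset.range K,
        concentrated (F p) j m ⊆ concentrated (F p) j (N j) :=
      (eventually_all_finset _).2 fun j _ => hN j m
    filter_upwards [hstab, hstab', hWU, eventually_ge_hyperfilter k, hsU (i + 1)]
      with p h1 h1' h2 hkp h3
    -- A point of `E i` outside these hulls could be modified beyond `m` so as to avoid all of `F
    -- p`. It would remain in `E i`, which `F p` covers.
    have hcovE : ∀ z ∈ E i ∩ Wᶜ, ∃ j ∈ Finset.Ico K m, ∃ e ∈ concentrated (F p) j m,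
        z ∈ hull m e.carrier := by
      rintro z ⟨hzE, hzW⟩
      by_contra! hno
      obtain ⟨y, hyz, hy⟩ := exists_agree_not_mem hkp (hF p) ((hw p).trans (by norm_num)) m z
        (fun e he hcard hze => by
          rcases lt_or_ge e.kind K with hlt | hge
          · have h4 := h1' e.kind (Finset.mem_range.2 hlt) (mem_concentrated.2 ⟨he, rfl, hcard⟩)
            have h5 : N e.kind ≤ n := Finset.le_sup (f := N) (Finset.mem_range.2 hlt)
            have h6 := (mem_concentrated.1 (concentrated_mono _ _ h5 h4)).2.2
            refine hzW (h2 ▸ Set.mem_biUnion (Finset.mem_filter.2 ⟨he, hlt, h6⟩) ?_)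
            exact hull_anti (le_max_left _ _) _ hze
          · refine hno e.kind (Finset.mem_Ico.2 ⟨hge, ?_⟩) e
              (mem_concentrated.2 ⟨he, rfl, hcard⟩) hze
            by_contra! hle
            -- A piece of type at least `m` has more than `2 * m` indices, too many for half of them
            -- to lie below `m`.
            have h4 := minCard_le_of_cost_lt ((cost_lt_of_sum_lt (hw p) he).trans (by norm_num))
            have h5 := minCard_mono hle
            have h6 := lt_minCard m
            have h7 := card_below_le m e.idx
            omega)
      have hyE : y ∈ E i := hEm (fun i hi => (hyz i hi).symm) hzE
      obtain ⟨e, he, hye⟩ := hcov p y (Set.mem_biUnion (Finset.mem_coe.2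
        (Finset.mem_range.2 h3)) hyE)
      exact hy e he hye
    refine (cov_le_sum_cov (C := family α p k) (Finset.Ico K m)
      (fun j => ⋃ e ∈ concentrated (F p) j m, hull m e.carrier) fun z hz => ?_).trans
      (Finset.sum_le_sum fun j hj => ?_)
    · obtain ⟨j, hj, e, he, hze⟩ := hcovE z hz
      exact ⟨j, hj, Set.mem_biUnion (Finset.mem_coe.2 he) hze⟩
    · refine (pre_biUnion_hull_le (hF p) (fun e he => (mem_concentrated.1 he).1)
        (fun e he => (mem_concentrated.1 he).2.2) (G := concentrated (F p) j m)
        fun z hz => ?_).trans ?_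
      · simpa only [Set.mem_iUnion, exists_prop] using hz
      · gcongr
        exact h1 j (Finset.mem_range.2 (Finset.mem_Ico.1 hj).2)

/-- If some finite union is already large, that union serves as `D`: it is disjoint from all later
terms. -/
lemma exists_large_cyl {E : ℕ → Set (∀ n, α n)} (hE : ∀ j, ∃ n, IsCyl n (E j))
    (hdisj : ∀ i j, i ≠ j → Disjoint (E i) (E j)) {η : ℝ≥0∞} (hη : 0 < η) :
    ∃ n D, IsCyl n D ∧ 2 ≤ limSub k D ∧ ∃ j₀, ∀ j ≥ j₀, limSub k (E j ∩ D) ≤ η := by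
  by_cases hsmall : ∀ s, limSub k (⋃ i ∈ Finset.range s, E i) < 2
  · obtain ⟨n, D, hD, hD2, hED⟩ := exists_large_cyl_of_small_unions hE hsmall hη
    exact ⟨n, D, hD, hD2, 0, fun j _ => hED j⟩
  · push Not at hsmall
    obtain ⟨s, hs⟩ := hsmall
    choose n hn using hE
    refine ⟨(Finset.range s).sup n, _, isCyl_iUnion fun i => isCyl_iUnion fun hi =>
      (hn i).mono (Finset.le_sup hi), hs, s, fun j hj => ?_⟩
    have : E j ∩ ⋃ i ∈ Finset.range s, E i = ∅ := by
      rw [← Set.disjoint_iff_inter_eq_empty]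
      simp only [Set.disjoint_iUnion_right]
      intro i hi
      exact hdisj j i (by have := Finset.mem_range.1 hi; omega)
    rw [this, limSub_empty]
    exact zero_le

/-- All cylinders of rank `m` contain large sets of finite rank that are disjoint from the terms
of a disjoint sequence, up to a small set. -/
lemma exists_thin_level {E : ℕ → Set (∀ n, α n)} (hE : ∀ j, ∃ n, IsCyl n (E j))
    (hdisj : ∀ i j, i ≠ j → Disjoint (E i) (E j)) {η : ℝ≥0∞} (hη : 0 < η) (m : ℕ) :
    ∃ n, m < n ∧ ∃ j₀, ∀ j ≥ j₀, ∃ Y, limSub k Y ≤ η ∧ ∀ a, ∃ D, IsCyl n D ∧ 2 ≤ limSub k D ∧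
      ∀ z ∈ D, splice m a z ∉ E j \ Y := by
  classical
  obtain ⟨R, hR⟩ := exists_representatives (α := α) m
  have hRne : (R.card : ℝ≥0∞) * R.card * 2 ≠ ∞ :=
    ENNReal.mul_ne_top (ENNReal.mul_ne_top (by simp) (by simp)) (by simp)
  -- The first bound permits `limSub_pullback_le`; the second pays `2 * c` for each pair of
  -- representatives.
  set c : ℝ≥0∞ := min (2⁻¹ ^ m) (η / ((R.card : ℝ≥0∞) * R.card * 2)) with hc
  have hc0 : 0 < c := lt_min (ENNReal.pow_pos (by simp) m) (ENNReal.div_pos hη.ne' hRne)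
  have hctop : c ≠ ∞ := ne_top_of_le_ne_top (by simp) (min_le_left _ _)
  have hkey : ∀ b : ∀ n, α n, ∃ n D, IsCyl n D ∧ 2 ≤ limSub k D ∧
      ∃ j₀, ∀ j ≥ j₀, limSub k ({z | splice m b z ∈ E j} ∩ D) ≤ c / 2 := by
    refine fun b => exists_large_cyl (fun j => ?_) (fun i j hij => ?_) (ENNReal.half_pos hc0.ne')
    · obtain ⟨n, hn⟩ := hE j
      refine ⟨n, fun z y hzy hz => hn (fun i hi => ?_) hz⟩
      simp only [splice, hzy i hi]
    · exact Set.disjoint_left.2 fun z hi hj => Set.disjoint_left.1 (hdisj i j hij) hi hj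
  choose n D hD hD2 j₀ hj₀ using hkey
  refine ⟨max (m + 1) (R.sup n), lt_max_of_lt_left m.lt_succ_self, R.sup j₀, fun j hj => ?_⟩
  -- Forgetting the first `m` coordinates makes membership survive a splice. The forgotten prefix is
  -- the second component of the pairs summed over below.
  let D' : (∀ n, α n) → Set (∀ n, α n) := fun b => {z | ∃ x, splice m x z ∈ D b}
  refine ⟨⋃ b ∈ R, {z | z ∈ E j ∧ (∀ i < m, z i = b i) ∧ z ∈ D' b}, ?_, fun a => ?_⟩
  · calc limSub k (⋃ b ∈ R, {z | z ∈ E j ∧ (∀ i < m, z i = b i) ∧ z ∈ D' b})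
        ≤ ∑ q ∈ R ×ˢ R, limSub k
            {z | splice m q.2 z ∈ {z | splice m q.1 z ∈ E j} ∩ D q.1} := by
          apply limSub_le_sum
          intro z hz
          obtain ⟨b, hb, hzE, hzb, x, hx⟩ := Set.mem_iUnion₂.1 hz
          obtain ⟨y, hy, hxy⟩ := hR x
          have hxy' : splice m y z = splice m x z := by
            funext i
            by_cases hi : i < m
            · rw [splice_of_lt hi, splice_of_lt hi, hxy i hi]
            · rw [splice_of_le (not_lt.1 hi), splice_of_le (not_lt.1 hi)]
          refine ⟨(b, y), Finset.mem_product.2 ⟨hb, hy⟩, ?_, ?_⟩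
          · change splice m b (splice m y z) ∈ E j
            rwa [splice_splice_self, splice_eq_self hzb]
          · change splice m y z ∈ D b
            rwa [hxy']
      _ ≤ ∑ _q ∈ R ×ˢ R, 2 * c := by
          refine Finset.sum_le_sum fun q hq => limSub_pullback_le (min_le_left _ _) ?_ _
          have hq1 := (Finset.mem_product.1 hq).1
          exact (hj₀ q.1 j ((Finset.le_sup hq1).trans hj)).trans_lt
            (ENNReal.half_lt_self hc0.ne' hctop)
      _ = (R.card : ℝ≥0∞) * R.card * 2 * c := by
          rw [Finset.sum_const, Finset.card_product, nsmul_eq_mul]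
          push_cast
          ring
      _ ≤ (R.card : ℝ≥0∞) * R.card * 2 * (η / ((R.card : ℝ≥0∞) * R.card * 2)) := by
          gcongr
          exact min_le_right _ _
      _ ≤ η := ENNReal.mul_div_le
  · obtain ⟨b, hb, hab⟩ := hR a
    refine ⟨D' b, ?_, (hD2 b).trans (limSub_mono fun z hz => ⟨z, ?_⟩), ?_⟩
    · rintro z y hzy ⟨x, hx⟩
      refine ⟨x, (hD b).mono ((Finset.le_sup hb).trans (le_max_right (m + 1) _)) (fun i hi => ?_) hx⟩
      simp only [splice, hzy i hi]
    · rwa [splice_eq_self fun _ _ => rfl]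
    · rintro z ⟨x, hx⟩ ⟨hzE, hzY⟩
      refine hzY (Set.mem_biUnion hb ⟨hzE, fun i hi => ?_, x, ?_⟩)
      · rw [splice_of_lt hi, hab i hi]
      · rwa [splice_splice_self]

/-- The terms of a disjoint sequence of sets of finite rank are thin along large sets of indices,
up to small sets. -/
lemma exists_thin_of_disjoint {E : ℕ → Set (∀ n, α n)} (hE : ∀ j, ∃ n, IsCyl n (E j))
    (hdisj : ∀ i j, i ≠ j → Disjoint (E i) (E j)) (N : ℕ) : ∀ {η : ℝ≥0∞}, 0 < η →
    ∃ (I : Finset ℕ) (M : ℕ), I.card = N ∧ (∀ m ∈ I, m < M) ∧ ∃ j₀, ∀ j ≥ j₀, ∃ Y,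
      limSub k Y ≤ η ∧ ∀ m ∈ I, ∀ n, n ∈ I ∨ M ≤ n → m < n → ∀ a, ∃ D, IsCyl n D ∧
        2 ≤ limSub k D ∧ ∀ z ∈ D, splice m a z ∉ E j \ Y := by
  classical
  induction N with
  | zero =>
    intro η hη
    exact ⟨∅, 0, rfl, by simp, 0, fun j _ => ⟨∅, by simp [limSub_empty], by simp⟩⟩
  | succ N ih =>
    intro η hη
    obtain ⟨I, M, hI, hIM, j₀, hj₀⟩ := ih (ENNReal.half_pos hη.ne')
    obtain ⟨M', hM', j₁, hj₁⟩ := exists_thin_level (k := k) hE hdisj (ENNReal.half_pos hη.ne') M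
    -- The induction hypothesis allows any upper level from `M` on, so `M` itself can join `I`.
    have hMI : M ∉ I := fun h => (hIM M h).false
    refine ⟨insert M I, M', by rw [Finset.card_insert_of_notMem hMI, hI], fun m hm => ?_,
      max j₀ j₁, fun j hj => ?_⟩
    · rcases Finset.mem_insert.1 hm with rfl | hm
      · exact hM'
      · exact (hIM m hm).trans hM'
    · obtain ⟨Y, hY, hT⟩ := hj₀ j ((le_max_left _ _).trans hj)
      obtain ⟨Y', hY', hT'⟩ := hj₁ j ((le_max_right _ _).trans hj)
      refine ⟨Y ∪ Y', (limSub_union_le Y Y').trans ?_, fun m hm n hn hmn a => ?_⟩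
      · calc limSub k Y + limSub k Y' ≤ η / 2 + η / 2 := add_le_add hY hY'
          _ = η := ENNReal.add_halves η
      · rcases Finset.mem_insert.1 hm with rfl | hm
        · have hn' : M' ≤ n := by
            rcases hn with hn | hn
            · rcases Finset.mem_insert.1 hn with rfl | hn
              · exact absurd hmn (lt_irrefl _)
              · exact absurd (hIM n hn) hmn.not_gt
            · exact hn
          obtain ⟨D, hD, hD2, hDX⟩ := hT' a
          exact ⟨D, hD.mono hn', hD2, fun z hz hzX =>
            hDX z hz ⟨hzX.1, fun h => hzX.2 (Or.inr h)⟩⟩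
        · have hn' : n ∈ I ∨ M ≤ n := by
            rcases hn with hn | hn
            · rcases Finset.mem_insert.1 hn with rfl | hn
              · exact Or.inr le_rfl
              · exact Or.inl hn
            · exact Or.inr (hM'.le.trans hn)
          obtain ⟨D, hD, hD2, hDX⟩ := hT m hm n hn' hmn a
          exact ⟨D, hD, hD2, fun z hz hzX => hDX z hz ⟨hzX.1, fun h => hzX.2 (Or.inl h)⟩⟩

/-- The limit submeasure is exhaustive on sets of finite rank. -/
theorem tendsto_limSub_zero {E : ℕ → Set (∀ n, α n)} (hE : ∀ j, ∃ n, IsCyl n (E j))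
    (hdisj : ∀ i j, i ≠ j → Disjoint (E i) (E j)) :
    Tendsto (fun j => limSub 0 (E j)) atTop (𝓝 0) := by
  rw [ENNReal.tendsto_atTop_zero]
  intro ε hε
  obtain ⟨k, hk⟩ := ENNReal.exists_inv_two_pow_lt (ENNReal.half_pos hε.ne').ne'
  obtain ⟨I, M, hI, -, j₀, hj₀⟩ := exists_thin_of_disjoint (k := k + 1) hE hdisj (maxCard k)
    (ENNReal.half_pos hε.ne')
  refine ⟨j₀, fun j hj => ?_⟩
  obtain ⟨Y, hY, hT⟩ := hj₀ j hj
  have hthin : Thin (fun B => limSub (k + 1) B / 2) I (E j \ Y) := by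
    intro m hm n hn hmn a
    obtain ⟨D, hD, hD2, hDX⟩ := hT m hm n (Or.inl hn) hmn a
    exact ⟨D, hD, (ENNReal.le_div_iff_mul_le (by simp) (by simp)).2 (by simpa using hD2), hDX⟩
  calc limSub 0 (E j) ≤ limSub 0 (E j \ Y ∪ Y) := limSub_mono (by simp)
    _ ≤ limSub 0 (E j \ Y) + limSub 0 Y := limSub_union_le _ _
    _ ≤ limSub k (E j \ Y) + limSub (k + 1) Y :=
        add_le_add (limSub_mono_index (Nat.zero_le _) _) (limSub_mono_index (Nat.zero_le _) _)
    _ ≤ ε / 2 + ε / 2 := add_le_add ((limSub_le_half_pow hthin hI).trans hk.le) hY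
    _ = ε := ENNReal.add_halves ε

end Exhaustive

/-! ### Finitely additive measures -/

section FinAdd

variable {β : Type*} [BooleanAlgebra β] {μ : β → ℝ}

lemma isSubmeasure_nonneg (h : IsSubmeasure μ) (A : β) : 0 ≤ μ A := by
  rw [← h.bot]
  exact h.mono _ _ bot_le

lemma isSubmeasure_sup_le (h : IsSubmeasure μ) {ι : Type*} (s : Finset ι) (A : ι → β) :
    μ (s.sup A) ≤ ∑ i ∈ s, μ (A i) := by
  classical
  induction s using Finset.induction_on with
  | empty => simp [h.bot]
  | insert i s hi ih =>
    rw [Finset.sup_insert, Finset.sum_insert hi]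
    exact (h.subadd _ _).trans (by gcongr)

lemma isFinAddMeasure_sup (h : IsFinAddMeasure μ) {ι : Type*} (s : Finset ι) (A : ι → β)
    (hA : ∀ i j, i ≠ j → Disjoint (A i) (A j)) : μ (s.sup A) = ∑ i ∈ s, μ (A i) := by
  classical
  induction s using Finset.induction_on with
  | empty => simp [h.bot]
  | insert i s hi ih =>
    rw [Finset.sup_insert, Finset.sum_insert hi, h.add _ _ ?_, ih]
    rw [Finset.disjoint_sup_right]
    exact fun j hj => hA i j fun hij => hi (hij ▸ hj)

/-- Among disjoint elements, one has measure at most the average. -/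
lemma exists_card_mul_le (h : IsFinAddMeasure μ) {ι : Type*} [Fintype ι] [Nonempty ι] (A : ι → β)
    (hA : ∀ i j, i ≠ j → Disjoint (A i) (A j)) : ∃ i, (Fintype.card ι : ℝ) * μ (A i) ≤ μ ⊤ := by
  by_contra! hlt
  have h1 : ∑ _i : ι, μ ⊤ < ∑ i : ι, (Fintype.card ι : ℝ) * μ (A i) :=
    Finset.sum_lt_sum_of_nonempty Finset.univ_nonempty fun i _ => hlt i
  rw [← Finset.mul_sum, ← isFinAddMeasure_sup h _ A hA, Finset.sum_const, nsmul_eq_mul,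
    Finset.card_univ] at h1
  exact (mul_le_mul_of_nonneg_left (h.mono _ _ le_top) (Nat.cast_nonneg _)).not_gt h1

end FinAdd

/-! ### Transfer to the Cantor set -/

section Cantor

/-- The space of sequences of blocks of bits, the `n`-th block having length `n + 1`. -/
abbrev Block (n : ℕ) : Type := Fin (n + 1) → Bool

/-- An enumeration of the bits of all blocks. -/
noncomputable def blockIndex : (Σ n : ℕ, Fin (n + 1)) ≃ ℕ :=
  Classical.choice (by
    have : Infinite (Σ n : ℕ, Fin (n + 1)) :=
      Infinite.of_injective (fun n => ⟨n, 0⟩) fun m n h => congrArg Sigma.fst h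
    exact nonempty_equiv_of_countable)

/-- The Cantor set is the product of all blocks. -/
noncomputable def cantorHomeo : Cantor ≃ₜ (∀ n, Block n) where
  toFun x n i := x (blockIndex ⟨n, i⟩)
  invFun y m := y (blockIndex.symm m).1 (blockIndex.symm m).2
  left_inv x := by simp
  right_inv y := funext fun n => funext fun i =>
    congrArg (fun q : Σ n, Fin (n + 1) => y q.1 q.2) (blockIndex.symm_apply_apply ⟨n, i⟩)
  continuous_toFun := by fun_prop
  continuous_invFun := by fun_prop

/-- By compactness, finitely many basic cylinders cover the set. -/
lemma exists_isCyl_of_isClopen {α : ℕ → Type*} [∀ n, Finite (α n)] [∀ n, TopologicalSpace (α n)]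
    [∀ n, DiscreteTopology (α n)] {U : Set (∀ n, α n)} (hU : IsClopen U) : ∃ n, IsCyl n U := by
  have h1 : ∀ x : U, ∃ n, PiNat.cylinder x.1 n ⊆ U := fun x => by
    obtain ⟨_, ⟨y, n, rfl⟩, hx, hsub⟩ :=
      (PiNat.isTopologicalBasis_cylinders α).exists_subset_of_mem_open x.2 hU.isOpen
    refine ⟨n, fun z hz => hsub ?_⟩
    rw [PiNat.mem_cylinder_iff] at hx hz ⊢
    exact fun i hi => (hz i hi).trans (hx i hi)
  choose n hn using h1
  obtain ⟨t, ht⟩ := hU.isClosed.isCompact.elim_finite_subcover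
    (fun x : U => PiNat.cylinder x.1 (n x)) (fun x => PiNat.isOpen_cylinder _ _ _)
    (fun x hx => Set.mem_iUnion.2 ⟨⟨x, hx⟩, PiNat.self_mem_cylinder _ _⟩)
  refine ⟨t.sup n, fun z y hzy hz => ?_⟩
  obtain ⟨x, hx, hzx⟩ := Set.mem_iUnion₂.1 (ht hz)
  refine hn x ?_
  rw [PiNat.mem_cylinder_iff] at hzx ⊢
  exact fun i hi => (hzy i (hi.trans_le (Finset.le_sup hx))).symm.trans (hzx i hi)

/-- The points of a clopen set, as sequences of blocks. -/
def blocks (A : Clopens Cantor) : Set (∀ n, Block n) := cantorHomeo.symm ⁻¹' A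

lemma exists_isCyl_blocks (A : Clopens Cantor) : ∃ n, IsCyl n (blocks A) :=
  exists_isCyl_of_isClopen (A.isClopen.preimage cantorHomeo.symm.continuous)

/-- The exhaustive submeasure on the clopen subsets of the Cantor set. -/
noncomputable def cantorSub (A : Clopens Cantor) : ℝ := (limSub 0 (blocks A)).toReal

lemma limSub_ne_top (B : Set (∀ n, Block n)) : limSub 0 B ≠ ∞ :=
  ne_top_of_le_ne_top limSub_univ_ne_top (limSub_mono (Set.subset_univ B))

lemma isSubmeasure_cantorSub : IsSubmeasure cantorSub where
  bot := by simp [cantorSub, blocks, limSub_empty]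
  mono A B h := ENNReal.toReal_mono (limSub_ne_top _) (limSub_mono fun _ hz => h hz)
  subadd A B := by
    unfold cantorSub
    rw [← ENNReal.toReal_add (limSub_ne_top _) (limSub_ne_top _)]
    exact ENNReal.toReal_mono (ENNReal.add_ne_top.2 ⟨limSub_ne_top _, limSub_ne_top _⟩)
      (limSub_union_le _ _)

lemma isExhaustive_cantorSub : IsExhaustive cantorSub := fun E hE => by
  have h := tendsto_limSub_zero (fun j => exists_isCyl_blocks (E j)) fun i j hij =>
    Set.disjoint_left.2 fun z hi hj =>
      Set.disjoint_left.1 (Clopens.coe_disjoint.2 (hE i j hij)) hi hj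
  exact (ENNReal.tendsto_toReal ENNReal.zero_ne_top).comp h

lemma vanishesOnlyAtBot_cantorSub : VanishesOnlyAtBot cantorSub := by
  classical
  intro A hA
  by_contra hne
  have hA0 : limSub 0 (blocks A) = 0 :=
    ((ENNReal.toReal_eq_zero_iff _).1 hA).resolve_right (limSub_ne_top _)
  obtain ⟨x, hx⟩ : (A : Set Cantor).Nonempty := by
    rw [Set.nonempty_iff_ne_empty]
    exact fun h => hne (Clopens.ext h)
  set y := cantorHomeo x with hy
  have hyA : y ∈ blocks A := by simpa [blocks, hy] using hx
  obtain ⟨n, hn⟩ := exists_isCyl_blocks A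
  obtain ⟨R, hR⟩ := exists_representatives (α := Block) n
  -- Swapping `b i` and `y i` in every coordinate carries the cylinder of `b` into `A`. Finitely
  -- many images of `A`, null by invariance, would cover the space.
  have h1 : limSub 0 (Set.univ : Set (∀ n, Block n)) ≤ ∑ b ∈ R,
      limSub 0 ((fun z i => Equiv.swap (b i) (y i) (z i)) ⁻¹' blocks A) := by
    refine limSub_le_sum R _ fun z _ => ?_
    obtain ⟨b, hb, hzb⟩ := hR z
    refine ⟨b, hb, hn (fun i hi => ?_) hyA⟩
    simp only [hzb i hi, Equiv.swap_apply_left]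
  simp only [limSub_preimage (fun i => Equiv.swap _ _), hA0, Finset.sum_const_zero] at h1
  exact (sixteen_le_limSub_univ.trans h1).not_gt (by norm_num)

/-- The set of points with a given block. -/
noncomputable def withBlock (n : ℕ) (τ : Block n) : Clopens Cantor :=
  ⟨{x | cantorHomeo x n = τ}, (isClopen_discrete {τ}).preimage
    ((continuous_apply n).comp cantorHomeo.continuous)⟩

lemma blocks_withBlock (n : ℕ) (τ : Block n) : blocks (withBlock n τ) = {z | z n = τ} := by
  ext z
  change cantorHomeo (cantorHomeo.symm z) n = τ ↔ z n = τ
  rw [Homeomorph.apply_symm_apply]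

lemma one_le_cantorSub_withBlock (n : ℕ) (τ : Block n) : 1 ≤ cantorSub (withBlock n τ) := by
  unfold cantorSub
  rw [blocks_withBlock, ← ENNReal.toReal_one]
  exact ENNReal.toReal_mono (limSub_ne_top _) (one_le_limSub_coordinate n τ)

lemma disjoint_withBlock (n : ℕ) {τ σ : Block n} (h : τ ≠ σ) :
    Disjoint (withBlock n τ) (withBlock n σ) := by
  rw [← Clopens.coe_disjoint, Set.disjoint_left]
  exact fun x hx hy => h ((show cantorHomeo x n = τ from hx).symm.trans hy)

lemma card_block (n : ℕ) : n ≤ Fintype.card (Block n) := by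
  rw [Fintype.card_fun, Fintype.card_bool, Fintype.card_fin]
  exact (Nat.le_succ n).trans Nat.lt_two_pow_self.le

lemma not_isUniformlyExhaustive_cantorSub : ¬ IsUniformlyExhaustive cantorSub := by
  intro h
  obtain ⟨n, hn⟩ := h (1 / 2) (by norm_num)
  obtain ⟨f⟩ : Nonempty (Fin n ↪ Block n) :=
    Function.Embedding.nonempty_of_card_le (by simpa using card_block n)
  obtain ⟨i, hi⟩ := hn (fun i => withBlock n (f i)) fun i j hij =>
    disjoint_withBlock n (f.injective.ne hij)
  linarith [one_le_cantorSub_withBlock n (f i)]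

lemma cantorSub_compl_sup_le {k : ℕ} {I : Finset ℕ} (hI : I.card = maxCard k) (τ : ∀ n, Block n) :
    cantorSub (I.sup fun n => withBlock n (τ n))ᶜ ≤ (1 / 2) ^ k := by
  have h1 : blocks (I.sup fun n => withBlock n (τ n))ᶜ ⊆ {z | ∀ n ∈ I, z n ≠ τ n} := by
    intro z hz n hn hzn
    refine hz ?_
    have h2 : withBlock n (τ n) ≤ I.sup fun n => withBlock n (τ n) :=
      Finset.le_sup (f := fun n => withBlock n (τ n)) hn
    refine h2 ?_
    have h3 : z ∈ blocks (withBlock n (τ n)) := by rwa [blocks_withBlock]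
    exact h3
  have h2 : limSub 0 (blocks (I.sup fun n => withBlock n (τ n))ᶜ) ≤ 2⁻¹ ^ k :=
    (limSub_mono h1).trans ((limSub_mono_index (Nat.zero_le k) _).trans (limSub_avoid_le hI τ))
  have h3 := ENNReal.toReal_mono (by simp) h2
  simpa [cantorSub] using h3

/-- For every measure there are sets that carry half of the mass and are small for the
submeasure. -/
lemma exists_small_half {μ : Clopens Cantor → ℝ} (hμ : IsFinAddMeasure μ) (k : ℕ) :
    ∃ A, cantorSub A ≤ (1 / 2) ^ k ∧ μ ⊤ / 2 ≤ μ A := by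
  choose τ hτ using fun n => exists_card_mul_le hμ (withBlock n) fun _ _ h => disjoint_withBlock n h
  obtain ⟨N, hN⟩ : ∃ N, N = maxCard k := ⟨_, rfl⟩
  have hN0 : (0 : ℝ) < N := by
    rw [hN]
    exact_mod_cast (Nat.pow_pos (by norm_num) : 0 < maxCard k)
  -- Levels from `2 * N` on have at least `2 * N` blocks, so each lightest block has mass at most `μ
  -- ⊤ / (2 * N)`, and `N` of them at most half of the total.
  set I := Finset.Ico (2 * N) (2 * N + N) with hI
  set B := I.sup fun n => withBlock n (τ n) with hB
  have hIN : I.card = N := by rw [hI, Nat.card_Ico]; omega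
  refine ⟨Bᶜ, cantorSub_compl_sup_le (hIN.trans hN) τ, ?_⟩
  have h1 : μ B ≤ ∑ _n ∈ I, μ ⊤ / (2 * N) := by
    refine (isSubmeasure_sup_le hμ.toIsSubmeasure I _).trans (Finset.sum_le_sum fun n hn => ?_)
    rw [le_div_iff₀ (by positivity), mul_comm]
    refine le_trans ?_ (hτ n)
    have h2 : 2 * N ≤ Fintype.card (Block n) := (Finset.mem_Ico.1 hn).1.trans (card_block n)
    exact mul_le_mul_of_nonneg_right (by exact_mod_cast h2)
      (isSubmeasure_nonneg hμ.toIsSubmeasure _)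
  rw [Finset.sum_const, hIN, nsmul_eq_mul] at h1
  have h2 : (N : ℝ) * (μ ⊤ / (2 * N)) = μ ⊤ / 2 := by field_simp
  have h3 : μ ⊤ ≤ μ B + μ Bᶜ := by
    rw [← sup_compl_eq_top (x := B)]
    exact hμ.subadd _ _
  linarith

lemma eq_zero_of_isAbsCont_cantorSub {μ : Clopens Cantor → ℝ} (hμ : IsFinAddMeasure μ)
    (h : IsAbsCont μ cantorSub) : μ = 0 := by
  have htop : μ ⊤ ≤ 0 := by
    by_contra! hpos
    obtain ⟨δ, hδ, hδμ⟩ := h (μ ⊤ / 4) (by positivity)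
    obtain ⟨k, hk⟩ := exists_pow_lt_of_lt_one hδ (by norm_num : (1 / 2 : ℝ) < 1)
    obtain ⟨A, hA, hμA⟩ := exists_small_half hμ k
    linarith [hδμ A (hA.trans hk.le)]
  funext A
  exact le_antisymm ((hμ.mono _ _ le_top).trans htop) (isSubmeasure_nonneg hμ.toIsSubmeasure A)

end Cantor

/-! ### The F-norm on locally constant functions -/

section Size

variable {ν : Clopens Cantor → ℝ}

lemma mem_absGE {f : CantorL0} {ε : ℝ} {x : Cantor} : x ∈ f.absGE ε ↔ ε ≤ |f x| := Iff.rfl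

lemma le_size (h : IsSubmeasure ν) {f : CantorL0} {ε : ℝ} (hε : ε ≤ ν (f.absGE ε)) :
    ε ≤ f.size ν :=
  le_csSup ⟨ν ⊤, fun _ hδ => le_trans hδ (h.mono _ _ le_top)⟩ hε

lemma apply_absGE_lt (h : IsSubmeasure ν) {f : CantorL0} {a : ℝ} (ha : f.size ν < a) :
    ν (f.absGE a) < a := by
  by_contra! hle
  exact (le_size h hle).not_gt ha

lemma size_nonneg (h : IsSubmeasure ν) (f : CantorL0) : 0 ≤ f.size ν :=
  le_size h (isSubmeasure_nonneg h _)

/-- For `ε > a` the set `{|f| ≥ ε}` is contained in `{|f| ≥ a}`, so its value is at most `a < ε`. -/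
lemma size_le (h : IsSubmeasure ν) {f : CantorL0} {a : ℝ} (ha : ν (f.absGE a) ≤ a) :
    f.size ν ≤ a := by
  refine csSup_le ⟨0, isSubmeasure_nonneg h _⟩ fun ε hε => ?_
  by_contra! hlt
  refine hlt.not_ge (le_trans hε ((h.mono _ _ fun x hx => ?_).trans ha))
  exact hlt.le.trans hx

lemma size_add_le (h : IsSubmeasure ν) (f g : CantorL0) :
    (f + g).size ν ≤ f.size ν + g.size ν := by
  refine le_of_forall_pos_le_add fun ε hε => ?_
  have hf := apply_absGE_lt h (lt_add_of_pos_right (f.size ν) (half_pos hε))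
  have hg := apply_absGE_lt h (lt_add_of_pos_right (g.size ν) (half_pos hε))
  have hle : (f + g).absGE (f.size ν + ε / 2 + (g.size ν + ε / 2)) ≤
      f.absGE (f.size ν + ε / 2) ⊔ g.absGE (g.size ν + ε / 2) := by
    intro x hx
    by_contra hno
    have h1 : |f x| < f.size ν + ε / 2 := lt_of_not_ge fun hh => hno (Or.inl hh)
    have h2 : |g x| < g.size ν + ε / 2 := lt_of_not_ge fun hh => hno (Or.inr hh)
    have h3 : f.size ν + ε / 2 + (g.size ν + ε / 2) ≤ |f x + g x| := hx
    linarith [abs_add_le (f x) (g x)]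
  have := size_le h (((h.mono _ _ hle).trans (h.subadd _ _)).trans (add_lt_add hf hg).le)
  linarith

lemma size_zero (h : IsSubmeasure ν) : (0 : CantorL0).size ν = 0 := by
  refine le_antisymm (le_of_forall_pos_le_add fun ε hε => ?_) (size_nonneg h _)
  rw [zero_add]
  refine size_le h ?_
  have : (0 : CantorL0).absGE ε = ⊥ := by
    refine le_bot_iff.1 fun x hx => ?_
    have h1 : ε ≤ |(0 : ℝ)| := hx
    rw [abs_zero] at h1
    exact absurd h1 hε.not_ge
  rw [this, h.bot]
  exact hε.le

lemma size_neg (f : CantorL0) : (-f).size ν = f.size ν := by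
  have : ∀ ε, (-f).absGE ε = f.absGE ε := fun ε => by
    ext x
    change ε ≤ |-f x| ↔ ε ≤ |f x|
    rw [abs_neg]
  simp only [CantorL0.size, this]

lemma eq_zero_of_size_eq_zero (h : IsSubmeasure ν) (hν : VanishesOnlyAtBot ν) {f : CantorL0}
    (hf : f.size ν = 0) : f = 0 := by
  by_contra hne
  obtain ⟨x, hx⟩ : ∃ x, f x ≠ 0 := by
    by_contra! h0
    exact hne (LocallyConstant.ext h0)
  have h1 : ν (f.absGE |f x|) ≤ 0 := by
    refine le_of_forall_pos_le_add fun ε hε => ?_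
    rw [zero_add]
    have hpos : 0 < min ε |f x| := lt_min hε (abs_pos.2 hx)
    have h2 := apply_absGE_lt h (f := f) (by rwa [hf])
    refine (h.mono _ _ fun y hy => ?_).trans (h2.le.trans (min_le_left _ _))
    exact (min_le_right ε _).trans (mem_absGE.1 hy)
  have h2 := hν _ (le_antisymm h1 (isSubmeasure_nonneg h _))
  have h3 : x ∈ f.absGE |f x| := le_refl |f x|
  rw [h2] at h3
  exact h3

/-- The size as a norm on the additive group of locally constant functions. -/
noncomputable def sizeNorm (h : IsSubmeasure ν) (hν : VanishesOnlyAtBot ν) :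
    AddGroupNorm CantorL0 where
  toFun f := f.size ν
  map_zero' := size_zero h
  add_le' := size_add_le h
  neg' := size_neg
  eq_zero_of_map_eq_zero' _ := eq_zero_of_size_eq_zero h hν

/-- The factor exceeds `|a|` to rescale the threshold, and is at least `1` because the bound on `ν`
does not rescale. -/
lemma size_smul_le (h : IsSubmeasure ν) (a : ℝ) (f : CantorL0) :
    (a • f).size ν ≤ (|a| + 1) * f.size ν := by
  have hpos : 0 < |a| + 1 := by positivity
  refine le_of_forall_pos_le_add fun ε hε => ?_
  have hlt := apply_absGE_lt h (lt_add_of_pos_right (f.size ν) (div_pos hε hpos))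
  set s := f.size ν + ε / (|a| + 1) with hs
  have hs0 : 0 ≤ s := add_nonneg (size_nonneg h f) (div_pos hε hpos).le
  have heq : (|a| + 1) * f.size ν + ε = (|a| + 1) * s := by
    rw [hs]
    field_simp
  have hle : s ≤ (|a| + 1) * s := le_mul_of_one_le_left hs0 (by linarith [abs_nonneg a])
  rw [heq]
  refine size_le h ((h.mono _ _ fun x hx => ?_).trans (hlt.le.trans hle))
  have h1 : (|a| + 1) * s ≤ |a * f x| := hx
  rw [abs_mul] at h1
  refine mem_absGE.2 (le_of_mul_le_mul_left (h1.trans ?_) hpos)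
  gcongr
  linarith

lemma exists_abs_le (f : CantorL0) : ∃ C, ∀ x, |f x| ≤ C := by
  obtain ⟨C, hC⟩ := isCompact_univ.exists_bound_of_continuousOn f.continuous.continuousOn
  exact ⟨C, fun x => hC x trivial⟩

/-- This gives continuity in the scalar, which fails to follow from `size_smul_le`. It relies on
locally constant functions being bounded; at the threshold with `C + 1` the level set is empty. -/
lemma size_smul_le_of_bound (h : IsSubmeasure ν) (a : ℝ) {f : CantorL0} {C : ℝ}
    (hC : ∀ x, |f x| ≤ C) : (a • f).size ν ≤ |a| * (C + 1) := by
  rcases eq_or_ne a 0 with rfl | ha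
  · simp [size_zero h]
  · have ha' : 0 < |a| := abs_pos.2 ha
    have hC0 : 0 ≤ C := (abs_nonneg _).trans (hC default)
    refine size_le h ?_
    have : (a • f).absGE (|a| * (C + 1)) = ⊥ := by
      refine le_bot_iff.1 fun x hx => ?_
      have h1 : |a| * (C + 1) ≤ |a * f x| := hx
      rw [abs_mul] at h1
      have := le_of_mul_le_mul_left h1 ha'
      linarith [hC x]
    rw [this, h.bot]
    positivity

lemma size_indicator_le (h : IsSubmeasure ν) (A : Clopens Cantor) :
    (CantorL0.indicator A).size ν ≤ ν A := by
  refine le_of_forall_gt_imp_ge_of_dense fun a ha => size_le h ?_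
  refine (h.mono _ _ fun x hx => ?_).trans ha.le
  by_contra hxA
  have h1 : a ≤ |(A : Set Cantor).indicator (1 : Cantor → ℝ) x| := by
    rw [← LocallyConstant.coe_charFn (Y := ℝ) A.isClopen]
    exact hx
  rw [Set.indicator_of_notMem hxA, abs_zero] at h1
  linarith [isSubmeasure_nonneg h A]

lemma min_le_size_indicator (h : IsSubmeasure ν) (A : Clopens Cantor) :
    min 1 (ν A) ≤ (CantorL0.indicator A).size ν := by
  refine le_size h ((min_le_right _ _).trans (h.mono _ _ fun x hx => ?_))
  change min 1 (ν A) ≤ |(LocallyConstant.charFn ℝ A.isClopen) x|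
  rw [LocallyConstant.coe_charFn, Set.indicator_of_mem hx, Pi.one_apply, abs_one]
  exact min_le_left _ _

lemma isVectorMeasure_indicator : IsVectorMeasure CantorL0.indicator := fun A B hAB => by
  ext x
  change LocallyConstant.charFn ℝ _ x = LocallyConstant.charFn ℝ _ x + LocallyConstant.charFn ℝ _ x
  simp only [LocallyConstant.coe_charFn, Clopens.coe_sup]
  rw [Set.indicator_union_of_disjoint (Clopens.coe_disjoint.2 hAB)]

end Size

end ThinCover

open ThinCover

/-! ### The main theorem -/

theorem theorem1p4 :
    ∃ ν : Clopens Cantor → ℝ,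
      IsSubmeasure ν ∧ VanishesOnlyAtBot ν ∧ IsExhaustive ν ∧ ¬ IsUniformlyExhaustive ν ∧
      (∀ μ : Clopens Cantor → ℝ, IsFinAddMeasure μ → IsAbsCont μ ν → μ = 0) ∧
      ∃ _ : MetricSpace CantorL0,
        (∀ f g : CantorL0, dist f g = CantorL0.size ν (f - g)) ∧
        (∀ f g h : CantorL0, dist (f + h) (g + h) = dist f g) ∧
        IsTopologicalAddGroup CantorL0 ∧ ContinuousSMul ℝ CantorL0 ∧
        IsVectorMeasure CantorL0.indicator ∧
        IsExhaustive CantorL0.indicator ∧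
        ¬ ∃ μ : Clopens Cantor → ℝ, IsControlMeasure μ CantorL0.indicator := by
  have hs := isSubmeasure_cantorSub
  have hv := vanishesOnlyAtBot_cantorSub
  let inst : NormedAddCommGroup CantorL0 := (sizeNorm hs hv).toNormedAddCommGroup
  have hnorm : ∀ f : CantorL0, ‖f‖ = f.size cantorSub := fun _ => rfl
  have hdist : ∀ f g : CantorL0, dist f g = (f - g).size cantorSub := fun f g => by
    rw [dist_eq_norm, hnorm]
  refine ⟨cantorSub, hs, hv, isExhaustive_cantorSub, not_isUniformlyExhaustive_cantorSub,
    fun μ hμ h => eq_zero_of_isAbsCont_cantorSub hμ h, inst.toMetricSpace, hdist,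
    fun f g h => dist_add_right f g h, inferInstance, ?_, isVectorMeasure_indicator, ?_, ?_⟩
  · refine ContinuousSMul.of_nhds_zero ?_ (fun f => ?_) fun a => ?_
    · rw [tendsto_zero_iff_norm_tendsto_zero]
      refine squeeze_zero (fun _ => norm_nonneg _) (fun q => size_smul_le hs q.1 q.2) ?_
      have h1 : Tendsto (fun q : ℝ × CantorL0 => (|q.1| + 1) * ‖q.2‖) (𝓝 0 ×ˢ 𝓝 0)
          (𝓝 ((|(0 : ℝ)| + 1) * ‖(0 : CantorL0)‖)) :=
        (((continuous_abs.tendsto 0).comp tendsto_fst).add_const 1).mul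
          ((continuous_norm.tendsto 0).comp tendsto_snd)
      rw [norm_zero, mul_zero] at h1
      exact h1
    · obtain ⟨C, hC⟩ := exists_abs_le f
      rw [tendsto_zero_iff_norm_tendsto_zero]
      refine squeeze_zero (fun _ => norm_nonneg _)
        (fun a => size_smul_le_of_bound hs a hC) ?_
      simpa using (continuous_abs.tendsto (0 : ℝ)).mul_const (C + 1)
    · rw [tendsto_zero_iff_norm_tendsto_zero]
      refine squeeze_zero (fun _ => norm_nonneg _) (fun f => size_smul_le hs a f) ?_
      have h1 := (continuous_norm.tendsto (0 : CantorL0)).const_mul (|a| + 1)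
      rw [norm_zero, mul_zero] at h1
      exact h1
  · intro E hE
    rw [tendsto_zero_iff_norm_tendsto_zero]
    exact squeeze_zero (fun _ => norm_nonneg _) (fun n => size_indicator_le hs (E n))
      (isExhaustive_cantorSub E hE)
  · rintro ⟨μ, hμ, hctrl⟩
    obtain ⟨δ, hδ, hδμ⟩ := hctrl (1 / 2) (by norm_num)
    -- At this level there are more than `μ ⊤ / δ` disjoint sets `withBlock n τ`, so one has measure
    -- at most `δ`, yet its indicator has size at least `1`.
    obtain ⟨n, hn⟩ := exists_nat_gt (μ ⊤ / δ)
    obtain ⟨τ, hτ⟩ := exists_card_mul_le hμ (withBlock n) fun _ _ h => disjoint_withBlock n h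
    have h1 : μ (withBlock n τ) ≤ δ := by
      by_contra! hlt
      have h2 : (n : ℝ) ≤ Fintype.card (Block n) := by exact_mod_cast card_block n
      rw [div_lt_iff₀ hδ] at hn
      have h3 : (n : ℝ) * δ ≤ Fintype.card (Block n) * μ (withBlock n τ) := by gcongr
      linarith
    have h2 := hδμ _ h1
    rw [dist_zero_left, hnorm] at h2
    have h3 := min_le_size_indicator hs (withBlock n τ)
    rw [min_eq_left (one_le_cantorSub_withBlock n τ)] at h3
    linarith
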